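/- **Conventions.** A *dcpo* is a poset in which every directed (non-empty) subset has a least upper bound (lub). Write $x\ll y$ iff every directed $D$ with $y\le \mathrm{lub}(D)$ contains some $z\ge x$. A dcpo is *continuous* iff, for every $x$, $\{y\mid y\ll x\}$ is directed with lub $x$; a *continuous dcwo* is a continuous dcpo whose ordering is a well partial ordering. Open sets, closure $cl$ and continuity refer to the Scott topology. A partial map $f:S\to S$ is *partial continuous* iff $\mathrm{dom}\, f$ is open and $f(\mathrm{lub}\,D)=\mathrm{lub}\,f(D)$ for every directed $D\subseteq\mathrm{dom}\, f$. A *functional transition system* $\mathfrak S=(S,\stackrel F\to)$ is given by a finite set $F$ of partial maps $S\to S$, with $s\to s'$ iff $s'=f(s)$ for some $f\in F$. It is a *complete transition system* iff $S$ is a continuous dcwo and every $f\in F$ is partial continuous; it is a *complete WSTS* iff moreover it is a functional WSTS (the ordering is a well partial ordering, every $f\in F$ has an upward-closed domain and is monotonic on it). $F^*$ is the set of all compositions of maps in $F$ (including the identity). The *lub-acceleration* $g^\infty$ of $g$ has $\mathrm{dom}\, g^\infty=\mathrm{dom}\, g$, with $g^\infty(x)=\mathrm{lub}\{g^n(x)\mid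 n\in\mathbb N\}$ if $x<g(x)$, and $g^\infty(x)=g(x)$ otherwise. $\mathfrak S$ is *$\infty$-effective* iff, for some surjection $r:E\to S$ with $E\subseteq\mathbb N$ (a representation of states by codes), the ordering is decidable on codes, and every $f\in F$ and every $g^\infty$, $g\in F^*$, is computable on codes (membership in the domain is decidable, and the value is computable when defined). Finally $Cover_{\mathfrak S}(s)={\downarrow}Post^*_{\mathfrak S}({\downarrow}s)$. **Procedure $\mathbf{Clover}_{\mathfrak S}(s_0)$.** Start with $A=\{s_0\}$. While not every element of $Post_{\mathfrak S}(A)$ is below some element of $A$: choose fairly $(g,a)\in F^*\times A$ with $a\in\mathrm{dom}\, g$, and replace $A$ by $A\cup\{g^\infty(a)\}$. On exit return the set of maximal elements of $A$. With $A_m$ the value of $A$ at stage $m$, an infinite execution is *fair* iff for every $m$, every pair $(g,a)\in F^*\times A_m$ with $a\in \mathrm{dom}\, g$ is picked at some stage $n\ge m$. The procedure *terminates* iff it has no infinite fair execution. **Flattenings.** $\mathfrak S_1=(S_1,\stackrel{F_1}\to)$ with initial state $s_1$ is *flat* iff there are words $w_1,\dots,w_k\in F_1^*$ such that every sequence of transitions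 fireable from $s_1$ lies in $w_1^*w_2^*\cdots w_k^*$. A *continuous flattening* of $\mathfrak S$, with initial state $s_1$, is a complete transition system $\mathfrak S_1$ that is flat from $s_1$, with a continuous map $\varphi:S_1\to S$ and a map $\varphi:F_1\to F$ such that for all $f\in F_1$ and $s\in\mathrm{dom}\, f$: $\varphi(s)\in\mathrm{dom}\,\varphi(f)$ and $\varphi(f(s))=\varphi(f)(\varphi(s))$. Then $(\mathfrak S,s_0)$ is * *clover-flattable* iff some continuous flattening, with initial state $s_1$, satisfies $\varphi(s_1)=s_0$ and $cl(Cover_{\mathfrak S}(s_0))=cl(\varphi\langle cl(Cover_{\mathfrak S_1}(s_1))\rangle)$; * *weakly clover-flattable* iff some continuous flattening, with initial state $s_1$, satisfies $\varphi(s_1)\le s_0$ and $cl(Cover_{\mathfrak S}(s_0))\subseteq cl(\varphi\langle cl(Cover_{\mathfrak S_1}(s_1))\rangle)$; * *strongly clover-flattable* iff $cl(Cover_{\mathfrak S}(s_0))=cl(\pi_1\langle cl(Cover_{\mathfrak S\times\mathcal A}(s_0,q_0))\rangle)$ for some rl-automaton $\mathcal A=(F,Q,\delta,q_0)$, i.e.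 a finite automaton over the alphabet $F$ with partial deterministic transition function $\delta$, all states final, whose language is the set of prefixes of the words of some $w_1^*\cdots w_k^*$. Here the *synchronized product* $\mathfrak S\times\mathcal A$ has state space $S\times Q$ ordered by $(s,q)\le(s',q')$ iff $s\le s'$ and $q=q'$, and as transition maps the partial maps $(s,q)\mapsto(f(s),\delta(q,f))$, for those $f\in F$ such that $\delta(q,f)$ is defined for some $q$; $\pi_1$ is the first projection. **Theorem.** Let $\mathfrak S$ be an $\infty$-effective complete WSTS and $s_0$ a state of $\mathfrak S$. The following are equivalent: 1. $(\mathfrak S,s_0)$ is clover-flattable; 2. $(\mathfrak S,s_0)$ is weakly clover-flattable; 3. $(\mathfrak S,s_0)$ is strongly clover-flattable; 4. $\mathbf{Clover}_{\mathfrak S}(s_0)$ terminates. Moreover the non-determinism of the procedure is irrelevant to (4): $\mathbf{Clover}_{\mathfrak S}(s_0)$ terminates (i.e. has no infinite fair execution) iff at least one of its executions exits the loop after finitely many turns. -/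

import Mathlib

universe u

namespace WSTS

/-! ### Order-theoretic notions -/

section Order

variable {S : Type u} [PartialOrder S]

/-- Every directed (in particular, non-empty) subset has a least upper bound. -/
def IsDcpo (S : Type u) [PartialOrder S] : Prop :=
  ∀ D : Set S, D.Nonempty → DirectedOn (· ≤ ·) D → ∃ a, IsLUB D a

/-- The way-below relation `x ≪ y`. -/
def WayBelow (x y : S) : Prop :=
  ∀ D : Set S, D.Nonempty → DirectedOn (· ≤ ·) D → ∀ a, IsLUB D a → y ≤ a → ∃ z ∈ D, x ≤ z

/-- `S` is a continuous directed complete well (partial) order. -/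
structure IsContinuousDcwo (S : Type u) [PartialOrder S] : Prop where
  dcpo : IsDcpo S
  wpo : WellQuasiOrderedLE S
  nonempty : ∀ x : S, {y : S | WayBelow y x}.Nonempty
  directed : ∀ x : S, DirectedOn (· ≤ ·) {y : S | WayBelow y x}
  isLUB : ∀ x : S, IsLUB {y : S | WayBelow y x} x

/-- Closure in the Scott topology. -/
def cl (A : Set S) : Set S := @closure S (Topology.scott S Set.univ) A

/-- The domination (Hoare) quasi-ordering on sets: every element of `A` is below one of `B`. -/
def Dominated (A B : Set S) : Prop := ∀ a ∈ A, ∃ b ∈ B, a ≤ b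

/-- Partial monotonic maps: upward-closed domain, and monotonic on it. -/
def PartialMonotonic (f : S →. S) : Prop :=
  IsUpperSet f.Dom ∧ ∀ x y : S, x ≤ y → ∀ x' ∈ f x, ∀ y' ∈ f y, x' ≤ y'

/-- Partial continuous maps: Scott-open domain, and least upper bounds of directed subsets of the
domain are preserved. -/
def PartialContinuous (f : S →. S) : Prop :=
  @IsOpen S (Topology.scott S Set.univ) f.Dom ∧
    ∀ D : Set S, D ⊆ f.Dom → D.Nonempty → DirectedOn (· ≤ ·) D →
      ∀ a, IsLUB D a → ∃ b ∈ f a, IsLUB (f.image D) b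

end Order

/-! ### Iterates and lub-acceleration -/

/-- The `n`-fold composition of a partial map with itself. -/
def iter {S : Type u} (g : S →. S) : ℕ → (S →. S)
  | 0 => PFun.id S
  | n + 1 => g.comp (iter g n)

/-- The set `{gⁿ(x) | n ∈ ℕ}` (of those iterates that are defined). -/
def orbit {S : Type u} (g : S →. S) (x : S) : Set S := {y | ∃ n : ℕ, y ∈ iter g n x}

open Classical in
/-- The lub-acceleration `g^∞`: its domain is that of `g`, and for `x` in it, `g^∞(x)` is the least
upper bound of `{gⁿ(x) | n ∈ ℕ}` if `x < g(x)`, and `g(x)` otherwise. (If `g` is partial continuous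
on a dcpo and `x < g(x)`, then this least upper bound exists.) -/
noncomputable def accel {S : Type u} [PartialOrder S] (g : S →. S) : S →. S := fun x =>
  (g x).map fun z => if h : x < z ∧ ∃ y, IsLUB (orbit g x) y then h.2.choose else z

/-! ### Functional transition systems -/

/-- A functional transition system on the states `S`: a finite set `F` of partial maps. -/
structure FTS (S : Type u) where
  F : Set (S →. S)
  finite : F.Finite

namespace FTS

variable {S : Type u} (T : FTS S)

/-- The transition relation. -/
def Step (s s' : S) : Prop := ∃ f ∈ T.F, s' ∈ f s

/-- `Post(A)`: immediate successors of the states in `A`. -/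
def Post (A : Set S) : Set S := {s' | ∃ s ∈ A, T.Step s s'}

/-- The effect of firing a word of transitions, first letter first. -/
def run : List T.F → (S →. S)
  | [] => PFun.id S
  | f :: w => (run w).comp f.1

/-- `F*`: all compositions of maps in `F`. -/
def compositions : Set (S →. S) := {g | ∃ w : List T.F, g = T.run w}

/-- The cover of `s`: downward closure of the set of states reachable from states below `s`. -/
def Cover [PartialOrder S] (s : S) : Set S :=
  {t | ∃ s' ≤ s, ∃ t', Relation.ReflTransGen T.Step s' t' ∧ t ≤ t'}

/-- Complete (functional) transition systems. -/
structure IsComplete [PartialOrder S] : Prop where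
  dcwo : IsContinuousDcwo S
  continuous : ∀ f ∈ T.F, PartialContinuous f

/-- Functional WSTS. -/
structure IsFunctionalWSTS [PartialOrder S] : Prop where
  wpo : WellQuasiOrderedLE S
  monotonic : ∀ f ∈ T.F, PartialMonotonic f

/-- Complete WSTS: functional WSTS that are complete as functional transition systems. -/
structure IsCompleteWSTS [PartialOrder S] : Prop where
  wsts : T.IsFunctionalWSTS
  complete : T.IsComplete

end FTS

/-! ### Effectivity -/

/-- `f` is computable with respect to the representation map `r`: from any code `e` of a state `s`,
one can decide whether `s ∈ dom f`, and, if so, compute a code of `f s`. -/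
def ComputableOn {S : Type u} {E : Set ℕ} (r : E → S) (f : S →. S) : Prop :=
  ∃ φ : ℕ →. Option ℕ, Partrec φ ∧ ∀ e : E,
    (none ∈ φ e ∧ ¬ (f (r e)).Dom) ∨ ∃ k : E, some (k : ℕ) ∈ φ e ∧ r k ∈ f (r e)

/-- The ordering is decidable with respect to the representation map `r`. -/
def DecidableOn {S : Type u} [PartialOrder S] {E : Set ℕ} (r : E → S) : Prop :=
  ∃ d : ℕ × ℕ →. Bool, Partrec d ∧ ∀ e e' : E,
    ∃ b ∈ d ((e : ℕ), (e' : ℕ)), (b = true ↔ r e ≤ r e')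

/-- `∞`-effectivity: for some representation of the states by natural numbers, the ordering is
decidable, every transition map is computable, and so is the lub-acceleration of every composition
of transition maps. -/
def FTS.IsInftyEffective {S : Type u} [PartialOrder S] (T : FTS S) : Prop :=
  ∃ (E : Set ℕ) (r : E → S), Function.Surjective r ∧ DecidableOn r ∧
    (∀ f ∈ T.F, ComputableOn r f) ∧ ∀ g ∈ T.compositions, ComputableOn r (accel g)

/-! ### The procedure Clover -/

section Clover

variable {S : Type u} [PartialOrder S]

/-- The first `N` turns of the while loop started on `s₀` are executed, where `A n` is the
value of the variable `A` before turn `n`, and `pick n` is the pair chosen in turn `n`: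
the loop guard `Post(A) ≰ A` (for domination) holds, a pair `(g, a)` with `g ∈ F*`, `a ∈ A` and
`a ∈ dom g` is chosen, and `g^∞(a)` is added to `A`. -/
structure RunsFor (T : FTS S) (s₀ : S) (A : ℕ → Set S) (pick : ℕ → (S →. S) × S) (N : ℕ) :
    Prop where
  init : A 0 = {s₀}
  guard : ∀ n < N, ¬ Dominated (T.Post (A n)) (A n)
  choice : ∀ n < N, (pick n).1 ∈ T.compositions ∧ (pick n).2 ∈ A n ∧ ((pick n).1 (pick n).2).Dom
  update : ∀ n < N, ∃ y ∈ accel (pick n).1 (pick n).2, A (n + 1) = insert y (A n)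

/-- Fairness of the choices made in an infinite execution: every pair that is available at some
stage is picked at that stage or later. -/
def IsFair (T : FTS S) (A : ℕ → Set S) (pick : ℕ → (S →. S) × S) : Prop :=
  ∀ m : ℕ, ∀ g ∈ T.compositions, ∀ a ∈ A m, (g a).Dom → ∃ n ≥ m, pick n = (g, a)

/-- `Clover(s₀)` terminates: there is no infinite fair execution. -/
def CloverTerminates (T : FTS S) (s₀ : S) : Prop :=
  ¬ ∃ (A : ℕ → Set S) (pick : ℕ → (S →. S) × S), (∀ N, RunsFor T s₀ A pick N) ∧ IsFair T A pick

/-- Some execution of `Clover(s₀)` reaches the exit of the loop after finitely many turns. -/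
def CloverCanTerminate (T : FTS S) (s₀ : S) : Prop :=
  ∃ (A : ℕ → Set S) (pick : ℕ → (S →. S) × S) (N : ℕ),
    RunsFor T s₀ A pick N ∧ Dominated (T.Post (A N)) (A N)

end Clover

/-! ### Flattenings -/

/-- The bounded language `w₁* w₂* ⋯ w_k*`, for `ws = [w₁, …, w_k]`. -/
def boundedLanguage {α : Type u} (ws : List (List α)) : Language α :=
  (ws.map fun w => KStar.kstar ({w} : Language α)).prod

/-- The set of prefixes of the words of a language. -/
def prefixes {α : Type u} (L : Language α) : Language α := {v | ∃ w ∈ L, v <+: w}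

/-- The system `T` with initial state `s` is flat: all the sequences of transitions that can be
fired from `s` belong to a common language `w₁* w₂* ⋯ w_k*`. -/
def FTS.IsFlat {S : Type u} (T : FTS S) (s : S) : Prop :=
  ∃ ws : List (List T.F), ∀ w : List T.F, (T.run w s).Dom → w ∈ boundedLanguage ws

/-- `(T₁, φ)`, with initial state `s₁`, is a continuous flattening of `T₂`; here the morphism `φ`
consists of a map `φ` on states and a map `ψ` on transitions. -/
structure IsContinuousFlattening {S₁ S₂ : Type u} [PartialOrder S₁] [PartialOrder S₂]
    (T₁ : FTS S₁) (s₁ : S₁) (T₂ : FTS S₂) (φ : S₁ → S₂) (ψ : T₁.F → T₂.F) : Prop where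
  complete : T₁.IsComplete
  flat : T₁.IsFlat s₁
  morphism : ∀ (s s' : S₁) (f : T₁.F), s' ∈ f.1 s → φ s' ∈ (ψ f).1 (φ s)
  continuous : ScottContinuous φ

/-- `(T, s₀)` is clover-flattable. -/
def CloverFlattable {S : Type u} [PartialOrder S] (T : FTS S) (s₀ : S) : Prop :=
  ∃ (S₁ : Type u) (_ : PartialOrder S₁) (T₁ : FTS S₁) (s₁ : S₁) (φ : S₁ → S) (ψ : T₁.F → T.F),
    IsContinuousFlattening T₁ s₁ T φ ψ ∧ φ s₁ = s₀ ∧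
      cl (T.Cover s₀) = cl (φ '' cl (T₁.Cover s₁))

/-- `(T, s₀)` is weakly clover-flattable. -/
def WeaklyCloverFlattable {S : Type u} [PartialOrder S] (T : FTS S) (s₀ : S) : Prop :=
  ∃ (S₁ : Type u) (_ : PartialOrder S₁) (T₁ : FTS S₁) (s₁ : S₁) (φ : S₁ → S) (ψ : T₁.F → T.F),
    IsContinuousFlattening T₁ s₁ T φ ψ ∧ φ s₁ ≤ s₀ ∧
      cl (T.Cover s₀) ⊆ cl (φ '' cl (T₁.Cover s₁))

/-! ### Synchronized products with rl-automata -/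

/-- A deterministic finite automaton with a partial transition function, all of whose states are
final, and which recognizes the set of prefixes of the words in some `w₁* w₂* ⋯ w_k*`. -/
structure RLAutomaton (α : Type u) where
  Q : Type
  finite : Finite Q
  δ : Q → α → Option Q
  q₀ : Q
  isRL : ∃ ws : List (List α), ∀ w : List α,
    (w.foldlM δ q₀).isSome ↔ w ∈ prefixes (boundedLanguage ws)

/-- States of a synchronized product: pairs of a state and a control state. -/
@[ext]
structure ProdState (S : Type u) (Q : Type) where
  state : S
  control : Q

instance {S : Type u} {Q : Type} [PartialOrder S] : PartialOrder (ProdState S Q) where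
  le p p' := p.state ≤ p'.state ∧ p.control = p'.control
  le_refl p := ⟨le_refl _, rfl⟩
  le_trans _ _ _ h h' := ⟨h.1.trans h'.1, h.2.trans h'.2⟩
  le_antisymm _ _ h h' := ProdState.ext (le_antisymm h.1 h'.1) h.2

/-- The partial map `f ⋈ δ : (s, q) ↦ (f s, δ (q, f))`. -/
def bowtie {S : Type u} {T : FTS S} {Q : Type} (δ : Q → T.F → Option Q) (f : T.F) :
    ProdState S Q →. ProdState S Q := fun p =>
  (f.1 p.state).bind fun s' => (Part.ofOption (δ p.control f)).map fun q' => ⟨s', q'⟩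

/-- The synchronized product of a functional transition system with an rl-automaton over its
transition maps. -/
def syncProduct {S : Type u} (T : FTS S) (𝒜 : RLAutomaton T.F) : FTS (ProdState S 𝒜.Q) where
  F := {h | ∃ f : T.F, (∃ q, (𝒜.δ q f).isSome) ∧ h = bowtie 𝒜.δ f}
  finite := by
    have : Finite T.F := T.finite
    refine (Set.finite_range (bowtie 𝒜.δ)).subset ?_
    rintro h ⟨f, -, rfl⟩
    exact ⟨f, rfl⟩

/-- `(T, s₀)` is strongly clover-flattable. -/
def StronglyCloverFlattable {S : Type u} [PartialOrder S] (T : FTS S) (s₀ : S) : Prop :=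
  ∃ 𝒜 : RLAutomaton T.F,
    cl (T.Cover s₀) = cl (ProdState.state '' cl ((syncProduct T 𝒜).Cover ⟨s₀, 𝒜.q₀⟩))

end WSTS

/-!
The implications form a cycle through the existence of an execution of the procedure that exits
its loop:

  an execution exits ⟹ strongly clover-flattable ⟹ clover-flattable ⟹ weakly clover-flattable
    ⟹ no infinite fair execution ⟹ an execution exits.

* When the loop is exited, the downward closure of the final value of `A` is stable under the
  transitions, so it contains the cover. If turn `i` accelerated the composition of a word `wᵢ`,
  then every element of `A` is a limit of states reached from `s₀` by words of `w₀* w₁* ⋯`, by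
  continuity (`RunsFor.exists_boundedLanguage`). The prefixes of these words form a regular
  language (`isRegular_boundedLanguage`), and the synchronized product with the corresponding
  rl-automaton has the required cover (`CloverCanTerminate.stronglyCloverFlattable`).
* A synchronized product with an rl-automaton is itself a continuous flattening: `S × Q` is a
  finite sum of copies of `S`, hence a continuous dcwo (`IsContinuousDcwo.prodState`), and it is
  flat because prefixes of the words of a bounded language form a subset of a bounded language
  (`isFlat_syncProduct`).
* The heart of the matter is that a weak flattening forces fair executions to stop. The set of all
  states computed by an infinite fair execution is closed under accelerations. In any such set `X`,
  all the iterates `gⁿ(a)` of a composition `g` at some `a ∈ X` are dominated by *finitely many*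
  elements (`AccelClosed.exists_finite_iter_le`); this is where the well partial ordering is used.
  By iteration, so are all the states reached by words of `w₁* ⋯ w_k*`, hence, by Scott-closedness
  of downward closures of finite sets, the whole closed cover. Some value of `A` then dominates the
  closed cover, in which all successors of elements of `A` lie, and the loop guard fails
  (`WeaklyCloverFlattable.cloverTerminates`).
* If no execution exits, then a scheduler that enumerates the countably many pairs of a word and
  a computed state, each infinitely often, yields an infinite fair execution
  (`CloverTerminates.cloverCanTerminate`).

Effectivity matters for running the procedure, not for its termination. Topology enters only through
Scott-closed sets: a partial continuous `f` pulls a Scott-closed set `C` back to the Scott-closed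
set `f.core C` of the states that `f` does not send outside `C`
(`PartialContinuous.scottClosed_core`).
-/

namespace WSTS

/-! ### Composition of partial maps -/

lemma mem_comp {S : Type u} {f g : S →. S} {x y : S} : y ∈ g.comp f x ↔ ∃ z ∈ f x, y ∈ g z := by
  rw [PFun.comp_apply]
  exact Part.mem_bind_iff

/-! ### Scott-closed sets and partial continuous maps -/

section Order

variable {S : Type u} [PartialOrder S]

/-- Scott-closed sets, described through the order alone. -/
def ScottClosed (C : Set S) : Prop := IsLowerSet C ∧ DirSupClosed C

lemma isClosed_scott_iff {C : Set S} :
    @IsClosed S (Topology.scott S Set.univ) C ↔ ScottClosed C := by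
  let _ := Topology.scott S Set.univ
  have : Topology.IsScott S Set.univ := ⟨rfl⟩
  exact Topology.IsScott.isClosed_iff_isLowerSet_and_dirSupClosed

lemma isOpen_scott_iff {U : Set S} :
    @IsOpen S (Topology.scott S Set.univ) U ↔ ScottClosed Uᶜ := by
  let _ := Topology.scott S Set.univ
  rw [← isClosed_scott_iff, isClosed_compl_iff]

lemma scottClosed_cl (A : Set S) : ScottClosed (cl A) :=
  isClosed_scott_iff.1 (@isClosed_closure S (Topology.scott S Set.univ) A)

lemma subset_cl (A : Set S) : A ⊆ cl A := @subset_closure S (Topology.scott S Set.univ) A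

lemma cl_subset {A C : Set S} (hC : ScottClosed C) (h : A ⊆ C) : cl A ⊆ C :=
  @closure_minimal S (Topology.scott S Set.univ) A C h (isClosed_scott_iff.2 hC)

/-- Directed subsets of the downward closure of a finite set lie below one of its elements, which
is why such downward closures are Scott-closed. -/
lemma scottClosed_lowerClosure {A : Set S} (hA : A.Finite) :
    ScottClosed {x : S | ∃ a ∈ A, x ≤ a} := by
  have h : {x : S | ∃ a ∈ A, x ≤ a} = ⋃ a ∈ A, Set.Iic a := by ext; simp
  rw [h, ← isClosed_scott_iff]
  let _ := Topology.scott S Set.univ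
  have : Topology.IsScott S Set.univ := ⟨rfl⟩
  exact hA.isClosed_biUnion fun a _ => isClosed_Iic

lemma ScottClosed.preimage {S' : Type u} [PartialOrder S'] {C : Set S} (hC : ScottClosed C)
    {φ : S' → S} (hφ : ScottContinuous φ) : ScottClosed (φ ⁻¹' C) := by
  refine ⟨hC.1.preimage hφ.monotone, fun D hD hne hdir a ha => ?_⟩
  refine hC.2 (Set.image_subset_iff.2 hD) (hne.image φ) ?_ (hφ hne hdir ha)
  exact directedOn_image.2 (hdir.mono fun _ _ h => hφ.monotone h)

lemma PartialMonotonic.exists_le {f : S →. S} (hf : PartialMonotonic f) {x y x' : S}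
    (hxy : x ≤ y) (hx : x' ∈ f x) : ∃ y' ∈ f y, x' ≤ y' := by
  obtain ⟨y', hy⟩ := (PFun.mem_dom _ _).1 (hf.1 hxy ((PFun.mem_dom _ _).2 ⟨x', hx⟩))
  exact ⟨y', hy, hf.2 x y hxy x' hx y' hy⟩

lemma PartialMonotonic.directedOn_image {f : S →. S} (hf : PartialMonotonic f) {D : Set S}
    (hD : D ⊆ f.Dom) (hdir : DirectedOn (· ≤ ·) D) : DirectedOn (· ≤ ·) (f.image D) := by
  rintro x' ⟨x, hx, hx'⟩ y' ⟨y, hy, hy'⟩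
  obtain ⟨z, hz, hxz, hyz⟩ := hdir x hx y hy
  obtain ⟨z', hz'⟩ := (PFun.mem_dom _ _).1 (hD hz)
  exact ⟨z', ⟨z, hz, hz'⟩, hf.2 _ _ hxz _ hx' _ hz', hf.2 _ _ hyz _ hy' _ hz'⟩

lemma PartialContinuous.monotonic {f : S →. S} (hf : PartialContinuous f) :
    PartialMonotonic f := by
  have hup : IsUpperSet f.Dom := isLowerSet_compl.1 (isOpen_scott_iff.1 hf.1).1
  refine ⟨hup, fun x y hxy x' hx y' hy => ?_⟩
  have hxd : x ∈ f.Dom := (PFun.mem_dom _ _).2 ⟨x', hx⟩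
  -- continuity is applied to the directed pair `{x, y}`, whose least upper bound is `y`
  obtain ⟨b, hb, hlub⟩ := hf.2 {x, y}
    (by rintro z (rfl | rfl); exacts [hxd, hup hxy hxd]) ⟨x, by simp⟩
    (by
      rintro a ha b hb
      refine ⟨y, by simp, ?_, ?_⟩
      · rcases ha with rfl | rfl
        exacts [hxy, le_rfl]
      · rcases hb with rfl | rfl
        exacts [hxy, le_rfl])
    y (IsGreatest.isLUB ⟨by simp, by rintro z (rfl | rfl); exacts [hxy, le_rfl]⟩)
  rw [Part.mem_unique hy hb]
  exact hlub.1 ⟨x, by simp, hx⟩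

/-- The topological content of partial continuity: the states that `f` does not send outside a
Scott-closed set form a Scott-closed set. -/
lemma PartialContinuous.scottClosed_core {f : S →. S} (hf : PartialContinuous f) {C : Set S}
    (hC : ScottClosed C) : ScottClosed (f.core C) := by
  constructor
  · intro y x hxy hy x' hx
    obtain ⟨y', hy', hle⟩ := hf.monotonic.exists_le hxy hx
    exact hC.1 hle (hy hy')
  · intro D hD hne hdir a ha y hy
    -- since the domain is open, it contains a tail `D'` of `D`, and continuity applies to `D'`
    obtain ⟨d, hd, hdom⟩ : ∃ d ∈ D, d ∈ f.Dom := by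
      by_contra! h
      exact (isOpen_scott_iff.1 hf.1).2 h hne hdir ha ((PFun.mem_dom _ _).2 ⟨y, hy⟩)
    set D' : Set S := {x ∈ D | d ≤ x}
    have hD' : D' ⊆ f.Dom := fun x hx => hf.monotonic.1 hx.2 hdom
    have hne' : D'.Nonempty := ⟨d, hd, le_rfl⟩
    have hdir' : DirectedOn (· ≤ ·) D' := by
      rintro x ⟨hx, hdx⟩ z ⟨hz, -⟩
      obtain ⟨w, hw, hxw, hzw⟩ := hdir x hx z hz
      exact ⟨w, ⟨hw, hdx.trans hxw⟩, hxw, hzw⟩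
    have ha' : IsLUB D' a := by
      refine ⟨fun x hx => ha.1 hx.1, fun b hb => ha.2 fun x hx => ?_⟩
      obtain ⟨w, hw, hdw, hxw⟩ := hdir d hd x hx
      exact hxw.trans (hb ⟨hw, hdw⟩)
    obtain ⟨b, hb, hlub⟩ := hf.2 D' hD' hne' hdir' a ha'
    rw [Part.mem_unique hy hb]
    refine hC.2 ?_ ?_ (hf.monotonic.directedOn_image hD' hdir') hlub
    · rintro x' ⟨x, hx, hx'⟩
      exact hD hx.1 hx'
    · obtain ⟨y, hy⟩ := (PFun.mem_dom _ _).1 hdom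
      exact ⟨y, d, ⟨hd, le_rfl⟩, hy⟩

lemma partialContinuous_id : PartialContinuous (PFun.id S) := by
  have hdom : (PFun.id S).Dom = Set.univ := rfl
  refine ⟨by rw [hdom]; exact @isOpen_univ S (Topology.scott S Set.univ),
    fun D _ _ _ a ha => ⟨a, Part.mem_some a, ?_⟩⟩
  have : (PFun.id S).image D = D := by
    ext x
    simp [PFun.mem_image]
  rwa [this]

lemma PartialContinuous.comp {f g : S →. S} (hg : PartialContinuous g)
    (hf : PartialContinuous f) : PartialContinuous (g.comp f) := by
  have hcompl : (g.comp f).Domᶜ = f.core g.Domᶜ := by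
    ext x
    simp only [Set.mem_compl_iff, PFun.mem_dom, PFun.mem_core, mem_comp]
    grind
  refine ⟨?_, fun D hD hne hdir a ha => ?_⟩
  · rw [isOpen_scott_iff, hcompl]
    exact hf.scottClosed_core (isOpen_scott_iff.1 hg.1)
  · have hDf : D ⊆ f.Dom := fun x hx => by
      obtain ⟨y, hy⟩ := (PFun.mem_dom _ _).1 (hD hx)
      obtain ⟨z, hz, -⟩ := mem_comp.1 hy
      exact (PFun.mem_dom _ _).2 ⟨z, hz⟩
    have hDg : f.image D ⊆ g.Dom := by
      rintro y ⟨x, hx, hy⟩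
      obtain ⟨z, hz⟩ := (PFun.mem_dom _ _).1 (hD hx)
      obtain ⟨y', hy', hz'⟩ := mem_comp.1 hz
      rw [Part.mem_unique hy hy']
      exact (PFun.mem_dom _ _).2 ⟨z, hz'⟩
    obtain ⟨b, hb, hlub⟩ := hf.2 D hDf hne hdir a ha
    have hne' : (f.image D).Nonempty := by
      obtain ⟨x, hx⟩ := hne
      obtain ⟨y, hy⟩ := (PFun.mem_dom _ _).1 (hDf hx)
      exact ⟨y, x, hx, hy⟩
    obtain ⟨c, hc, hlub'⟩ := hg.2 _ hDg hne' (hf.monotonic.directedOn_image hDf hdir) b hlub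
    refine ⟨c, mem_comp.2 ⟨b, hb, hc⟩, ?_⟩
    have : (g.comp f).image D = g.image (f.image D) := by
      ext y
      simp only [PFun.mem_image, mem_comp]
      grind
    rwa [this]

lemma PartialContinuous.iter {g : S →. S} (hg : PartialContinuous g) :
    ∀ n, PartialContinuous (iter g n)
  | 0 => partialContinuous_id
  | n + 1 => hg.comp (PartialContinuous.iter hg n)

end Order

/-! ### Firing words of transitions -/

section Run

variable {S : Type u} (T : FTS S)

lemma FTS.run_append (v w : List T.F) : T.run (v ++ w) = (T.run w).comp (T.run v) := by
  induction v with
  | nil => exact (PFun.comp_id _).symm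
  | cons f v ih => rw [List.cons_append, FTS.run, ih, FTS.run, PFun.comp_assoc]

variable {T}

lemma FTS.mem_run_append {v w : List T.F} {x y : S} :
    y ∈ T.run (v ++ w) x ↔ ∃ z ∈ T.run v x, y ∈ T.run w z := by
  rw [T.run_append, mem_comp]

lemma FTS.mem_run_cons {f : T.F} {w : List T.F} {x y : S} :
    y ∈ T.run (f :: w) x ↔ ∃ z ∈ f.1 x, y ∈ T.run w z := by
  rw [FTS.run, mem_comp]

lemma FTS.mem_run_nil {x y : S} : y ∈ T.run [] x ↔ y = x := Part.mem_some_iff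

lemma iter_add (g : S →. S) (m n : ℕ) : iter g (m + n) = (iter g n).comp (iter g m) := by
  induction n with
  | zero => exact (PFun.id_comp _).symm
  | succ n ih => rw [← add_assoc, iter, ih, iter, PFun.comp_assoc]

lemma mem_iter_add {g : S →. S} {m n : ℕ} {x y : S} :
    y ∈ iter g (m + n) x ↔ ∃ z ∈ iter g m x, y ∈ iter g n z := by
  rw [iter_add, mem_comp]

lemma iter_one (g : S →. S) : iter g 1 = g := PFun.comp_id g

lemma iter_iter (g : S →. S) (k n : ℕ) : iter (iter g k) n = iter g (k * n) := by
  induction n with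
  | zero => rfl
  | succ n ih => rw [iter, ih, Nat.mul_succ, iter_add]

lemma FTS.iter_run (w : List T.F) (n : ℕ) :
    iter (T.run w) n = T.run (List.replicate n w).flatten := by
  induction n with
  | zero => rfl
  | succ n ih => rw [iter, ih, List.replicate_succ', List.flatten_append, T.run_append]; simp

lemma FTS.run_mem_compositions (w : List T.F) : T.run w ∈ T.compositions := ⟨w, rfl⟩

lemma FTS.iter_mem_compositions {g : S →. S} (hg : g ∈ T.compositions) (n : ℕ) :
    iter g n ∈ T.compositions := by
  obtain ⟨w, rfl⟩ := hg
  exact ⟨_, T.iter_run w n⟩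

lemma FTS.reflTransGen_step_iff {s t : S} :
    Relation.ReflTransGen T.Step s t ↔ ∃ w : List T.F, t ∈ T.run w s := by
  constructor
  · intro h
    induction h with
    | refl => exact ⟨[], Part.mem_some s⟩
    | tail _ hstep ih =>
      obtain ⟨w, hw⟩ := ih
      obtain ⟨f, hf, hft⟩ := hstep
      exact ⟨w ++ [⟨f, hf⟩], FTS.mem_run_append.2
        ⟨_, hw, FTS.mem_run_cons.2 ⟨_, hft, Part.mem_some _⟩⟩⟩
  · rintro ⟨w, hw⟩
    induction w generalizing s with
    | nil => rw [FTS.mem_run_nil.1 hw]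
    | cons f w ih =>
      obtain ⟨z, hz, hzt⟩ := FTS.mem_run_cons.1 hw
      exact .head ⟨f.1, f.2, hz⟩ (ih hzt)

lemma FTS.IsComplete.partialContinuous_run [PartialOrder S] (hT : T.IsComplete) :
    ∀ w : List T.F, PartialContinuous (T.run w)
  | [] => partialContinuous_id
  | f :: w => (hT.partialContinuous_run w).comp (hT.continuous f.1 f.2)

lemma FTS.IsComplete.partialContinuous_of_mem_compositions [PartialOrder S] (hT : T.IsComplete)
    {g : S →. S} (hg : g ∈ T.compositions) : PartialContinuous g := by
  obtain ⟨w, rfl⟩ := hg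
  exact hT.partialContinuous_run w

/-- The states reached from `s` by firing the words of a language. -/
def FTS.reachBy (T : FTS S) (L : Language T.F) (s : S) : Set S := {t | ∃ v ∈ L, t ∈ T.run v s}

lemma FTS.IsComplete.exists_run_of_mem_Cover [PartialOrder S] (hT : T.IsComplete) {s t : S}
    (ht : t ∈ T.Cover s) : ∃ w : List T.F, ∃ t' ∈ T.run w s, t ≤ t' := by
  obtain ⟨s', hs', t', hst, htt⟩ := ht
  obtain ⟨w, hw⟩ := FTS.reflTransGen_step_iff.1 hst
  obtain ⟨t'', ht'', hle⟩ := (hT.partialContinuous_run w).monotonic.exists_le hs' hw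
  exact ⟨w, t'', ht'', htt.trans hle⟩

lemma FTS.IsComplete.cl_Cover_subset_core [PartialOrder S] (hT : T.IsComplete) (s : S)
    {f : S →. S} (hf : f ∈ T.F) : cl (T.Cover s) ⊆ f.core (cl (T.Cover s)) := by
  refine cl_subset ((hT.continuous f hf).scottClosed_core (scottClosed_cl _)) ?_
  rintro x ⟨s', hs', t', hst, hxt⟩ y hy
  obtain ⟨y', hy', hle⟩ := (hT.continuous f hf).monotonic.exists_le hxt hy
  exact subset_cl _ ⟨s', hs', y', hst.tail ⟨f, hf, hy'⟩, hle⟩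

end Run

/-! ### Lub-accelerations -/

section Accel

variable {S : Type u} [PartialOrder S] {g : S →. S} {x y z t : S}

lemma accel_dom : (accel g x).Dom ↔ (g x).Dom := Iff.rfl

/-- The iterates of a monotonic partial map at `x ≤ g x` form an increasing sequence. -/
lemma exists_iter_le (hg : PartialMonotonic g) (hz : z ∈ g x) (hxz : x ≤ z) {n : ℕ}
    (ht : t ∈ iter g n x) : ∃ t' ∈ iter g (n + 1) x, t ≤ t' := by
  induction n generalizing t with
  | zero =>
    rw [show t = x from Part.mem_some_iff.1 ht]
    exact ⟨z, by rwa [iter_one], hxz⟩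
  | succ n ih =>
    obtain ⟨a, ha, hat⟩ := mem_comp.1 ht
    obtain ⟨b, hb, hab⟩ := ih ha
    obtain ⟨c, hc, htc⟩ := hg.exists_le hab hat
    exact ⟨c, mem_comp.2 ⟨b, hb, hc⟩, htc⟩

lemma exists_iter_add_le (hg : PartialMonotonic g) (hz : z ∈ g x) (hxz : x ≤ z) {n : ℕ}
    (ht : t ∈ iter g n x) (k : ℕ) : ∃ t' ∈ iter g (n + k) x, t ≤ t' := by
  induction k with
  | zero => exact ⟨t, ht, le_rfl⟩
  | succ k ih =>
    obtain ⟨a, ha, hta⟩ := ih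
    obtain ⟨b, hb, hab⟩ := exists_iter_le hg hz hxz ha
    exact ⟨b, hb, hta.trans hab⟩

lemma directedOn_orbit (hg : PartialMonotonic g) (hz : z ∈ g x) (hxz : x ≤ z) :
    DirectedOn (· ≤ ·) (orbit g x) := by
  rintro a ⟨m, ha⟩ b ⟨n, hb⟩
  obtain ⟨a', ha', haa⟩ := exists_iter_add_le hg hz hxz ha n
  obtain ⟨b', hb', hbb⟩ := exists_iter_add_le hg hz hxz hb m
  rw [add_comm] at hb'
  rw [Part.mem_unique hb' ha'] at hbb
  exact ⟨a', ⟨_, ha'⟩, haa, hbb⟩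

lemma orbit_nonempty {S : Type u} (g : S →. S) (x : S) : (orbit g x).Nonempty :=
  ⟨x, 0, Part.mem_some x⟩

lemma isLUB_of_mem_accel (hS : IsDcpo S) (hg : PartialMonotonic g) (hz : z ∈ g x) (hxz : x < z)
    (hy : y ∈ accel g x) : IsLUB (orbit g x) y := by
  have h : x < z ∧ ∃ y, IsLUB (orbit g x) y :=
    ⟨hxz, hS _ (orbit_nonempty g x) (directedOn_orbit hg hz hxz.le)⟩
  obtain ⟨z', hz', rfl⟩ := (Part.mem_map_iff _).1 hy
  rw [Part.mem_unique hz' hz, dif_pos h]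
  exact h.2.choose_spec

lemma eq_of_mem_accel (hz : z ∈ g x) (hxz : ¬ x < z) (hy : y ∈ accel g x) : y = z := by
  obtain ⟨z', hz', rfl⟩ := (Part.mem_map_iff _).1 hy
  rw [Part.mem_unique hz' hz, dif_neg fun h => hxz h.1]

lemma exists_mem_accel (hz : z ∈ g x) : ∃ y, y ∈ accel g x :=
  Part.dom_iff_mem.1 (accel_dom.2 (Part.dom_iff_mem.2 ⟨z, hz⟩))

lemma le_of_mem_accel (hS : IsDcpo S) (hg : PartialMonotonic g) (hz : z ∈ g x)
    (hy : y ∈ accel g x) : z ≤ y := by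
  by_cases hxz : x < z
  · exact (isLUB_of_mem_accel hS hg hz hxz hy).1 ⟨1, by rwa [iter_one]⟩
  · exact (eq_of_mem_accel hz hxz hy).ge

/-- If `x ≤ g x`, then `g^∞ x` bounds all the iterates of `g` at `x`. -/
lemma iter_le_of_mem_accel (hS : IsDcpo S) (hg : PartialMonotonic g) (hz : z ∈ g x) (hxz : x ≤ z)
    (hy : y ∈ accel g x) {n : ℕ} (ht : t ∈ iter g n x) : t ≤ y := by
  rcases hxz.lt_or_eq with hlt | rfl
  · exact (isLUB_of_mem_accel hS hg hz hlt hy).1 ⟨n, ht⟩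
  · have hconst : ∀ n, ∀ t ∈ iter g n x, t = x := by
      intro n
      induction n with
      | zero => exact fun t ht => Part.mem_some_iff.1 ht
      | succ n ih =>
        intro t ht
        obtain ⟨a, ha, hat⟩ := mem_comp.1 ht
        rw [ih a ha] at hat
        exact Part.mem_unique hat hz
    rw [hconst n t ht, eq_of_mem_accel hz (lt_irrefl x) hy]

/-- A Scott-closed set that contains all the iterates of `g` at `x` contains `g^∞ x`. -/
lemma ScottClosed.mem_of_mem_accel {C : Set S} (hC : ScottClosed C) (hS : IsDcpo S)
    (hg : PartialMonotonic g) (hiter : orbit g x ⊆ C) (hy : y ∈ accel g x) : y ∈ C := by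
  obtain ⟨z, hz, -⟩ := (Part.mem_map_iff _).1 hy
  by_cases hxz : x < z
  · exact hC.2 hiter (orbit_nonempty g x) (directedOn_orbit hg hz hxz.le)
      (isLUB_of_mem_accel hS hg hz hxz hy)
  · rw [eq_of_mem_accel hz hxz hy]
    exact hiter ⟨1, by rwa [iter_one]⟩

lemma orbit_subset_of_subset_core {S : Type u} {g : S →. S} {x : S} {C : Set S}
    (hC : C ⊆ g.core C) (hx : x ∈ C) :
    orbit g x ⊆ C := by
  rintro t ⟨n, ht⟩
  induction n generalizing t with
  | zero => rwa [show t = x from Part.mem_some_iff.1 ht]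
  | succ n ih =>
    obtain ⟨a, ha, hat⟩ := mem_comp.1 ht
    exact hC (ih ha) hat

lemma FTS.subset_core_run {S : Type u} {T : FTS S} {C : Set S}
    (hC : ∀ f ∈ T.F, C ⊆ f.core C) (w : List T.F) :
    C ⊆ (T.run w).core C := by
  induction w with
  | nil =>
    intro x hx y hy
    rwa [FTS.mem_run_nil.1 hy]
  | cons f w ih =>
    intro x hx y hy
    obtain ⟨z, hz, hzy⟩ := FTS.mem_run_cons.1 hy
    exact ih (hC f.1 f.2 hx hz) hzy

end Accel

/-! ### Dominating iterates by finitely many accelerations -/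

section Dominate

variable {S : Type u} [PartialOrder S] {T : FTS S}

/-- Closure of a set of states under the lub-accelerations of all compositions of transitions. -/
def AccelClosed (T : FTS S) (X : Set S) : Prop :=
  ∀ g ∈ T.compositions, ∀ a ∈ X, ∀ y ∈ accel g a, y ∈ X

/-- Each single iterate of `g` at `a` lies below the corresponding acceleration `(gⁿ)^∞(a)`. -/
lemma AccelClosed.exists_iter_le {X : Set S} (hX : AccelClosed T X) (hT : T.IsComplete)
    {g : S →. S} (hg : g ∈ T.compositions) {a : S} (ha : a ∈ X) (n : ℕ) :
    ∃ b ∈ X, ∀ t ∈ iter g n a, t ≤ b := by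
  by_cases h : ∃ t, t ∈ iter g n a
  · obtain ⟨t, ht⟩ := h
    obtain ⟨y, hy⟩ := exists_mem_accel ht
    have hgn := FTS.iter_mem_compositions hg n
    refine ⟨y, hX _ hgn a ha y hy, fun t' ht' => ?_⟩
    exact le_of_mem_accel hT.dcwo.dcpo (hT.partialContinuous_of_mem_compositions hgn).monotonic
      ht' hy
  · exact ⟨a, ha, fun t ht => (h ⟨t, ht⟩).elim⟩

/-- If the iterates of `g` at `a` from rank `n` on are dominated by finitely many elements of an
acceleration-closed set, then so are all of them. -/
lemma AccelClosed.exists_finite_of_tail {X : Set S} (hX : AccelClosed T X) (hT : T.IsComplete)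
    {g : S →. S} (hg : g ∈ T.compositions) {a : S} (ha : a ∈ X) (n : ℕ)
    (htail : ∃ A ⊆ X, A.Finite ∧ ∀ m, n ≤ m → ∀ t ∈ iter g m a, ∃ b ∈ A, t ≤ b) :
    ∃ A ⊆ X, A.Finite ∧ ∀ m, ∀ t ∈ iter g m a, ∃ b ∈ A, t ≤ b := by
  obtain ⟨A, hAX, hA, hdom⟩ := htail
  choose c hcX hc using hX.exists_iter_le hT hg ha
  refine ⟨A ∪ c '' Set.Iio n, Set.union_subset hAX ?_, hA.union ((Set.finite_Iio n).image c),
    fun m t ht => ?_⟩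
  · rintro _ ⟨m, -, rfl⟩
    exact hcX m
  · rcases lt_or_ge m n with hmn | hmn
    · exact ⟨c m, Or.inr ⟨m, hmn, rfl⟩, hc m t ht⟩
    · obtain ⟨b, hb, htb⟩ := hdom m hmn t ht
      exact ⟨b, Or.inl hb, htb⟩

/-- All the iterates of `g` at `a` are dominated by finitely many elements of any
acceleration-closed set that contains `a`. Repeatedly applying `g^∞` from `a` on, either a state
`b` is met with `b ≤ g b` or `b ∉ dom g`, and then `g^∞ b` (or `b`) dominates a tail of the
iterates; or else the states met are just the iterates `gⁿ a`, and two of them satisfy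
`gⁱ a ≤ gⁱ⁺ᵏ a` because the ordering is a well partial ordering, so that the accelerations of `gᵏ`
at the `k` states `gⁱ a, …, gⁱ⁺ᵏ⁻¹ a` dominate a tail of the iterates. -/
lemma AccelClosed.exists_finite_iter_le {X : Set S} (hX : AccelClosed T X) (hT : T.IsComplete)
    {g : S →. S} (hg : g ∈ T.compositions) {a : S} (ha : a ∈ X) :
    ∃ A ⊆ X, A.Finite ∧ ∀ n, ∀ t ∈ iter g n a, ∃ b ∈ A, t ≤ b := by
  have hS := hT.dcwo.dcpo
  have hgm : ∀ n, PartialMonotonic (iter g n) := fun n =>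
    ((hT.partialContinuous_of_mem_compositions hg).iter n).monotonic
  have hgm1 : PartialMonotonic g := (hT.partialContinuous_of_mem_compositions hg).monotonic
  by_cases hcase : ∃ n, ∃ b ∈ X, (∀ t ∈ iter g n a, t ≤ b) ∧ ∀ z ∈ g b, b ≤ z
  · obtain ⟨n, b, hb, hnb, hbz⟩ := hcase
    refine hX.exists_finite_of_tail hT hg ha n ?_
    by_cases hdom : ∃ z, z ∈ g b
    · obtain ⟨z, hz⟩ := hdom
      obtain ⟨y, hy⟩ := exists_mem_accel hz
      refine ⟨{y}, by simpa using hX g hg b hb y hy, Set.finite_singleton y, fun m hm t ht => ?_⟩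
      obtain ⟨j, rfl⟩ := Nat.exists_eq_add_of_le hm
      obtain ⟨s, hs, hst⟩ := mem_iter_add.1 ht
      obtain ⟨t', ht', htt⟩ := (hgm j).exists_le (hnb s hs) hst
      exact ⟨y, rfl, htt.trans (iter_le_of_mem_accel hS hgm1 hz (hbz z hz) hy ht')⟩
    · refine ⟨{b}, by simpa using hb, Set.finite_singleton b, fun m hm t ht => ?_⟩
      obtain ⟨j, rfl⟩ := Nat.exists_eq_add_of_le hm
      obtain ⟨s, hs, hst⟩ := mem_iter_add.1 ht
      obtain ⟨t', ht', htt⟩ := (hgm j).exists_le (hnb s hs) hst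
      rcases j with _ | j
      · exact ⟨b, rfl, htt.trans (Part.mem_some_iff.1 ht').le⟩
      · rw [add_comm] at ht'
        obtain ⟨z, hz, -⟩ := mem_iter_add.1 ht'
        rw [iter_one] at hz
        exact (hdom ⟨z, hz⟩).elim
  · push Not at hcase
    have hall : ∀ n, ∃ t ∈ iter g n a, t ∈ X := by
      intro n
      induction n with
      | zero => exact ⟨a, Part.mem_some a, ha⟩
      | succ n ih =>
        obtain ⟨t, ht, htX⟩ := ih
        obtain ⟨z, hz, htz⟩ := hcase n t htX fun t' ht' => (Part.mem_unique ht' ht).le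
        obtain ⟨y, hy⟩ := exists_mem_accel hz
        have hyX := hX g hg t htX y hy
        rw [eq_of_mem_accel hz (fun h => htz h.le) hy] at hyX
        exact ⟨z, mem_comp.2 ⟨t, ht, hz⟩, hyX⟩
    choose s hs hsX using hall
    obtain ⟨i, j, hij, hle⟩ := hT.dcwo.wpo.wqo s
    obtain ⟨k, rfl⟩ := Nat.exists_eq_add_of_lt hij
    have hstep : ∀ m l, s (m + l) ∈ iter g l (s m) := fun m l => by
      obtain ⟨z, hz, h⟩ := mem_iter_add.1 (hs (m + l))
      rwa [Part.mem_unique hz (hs m)] at h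
    have hk := FTS.iter_mem_compositions hg (k + 1)
    choose y hy using fun l => exists_mem_accel (hstep (i + l) (k + 1))
    refine hX.exists_finite_of_tail hT hg ha i
      ⟨y '' Set.Iio (k + 1), ?_, (Set.finite_Iio _).image y, fun m hm t ht => ?_⟩
    · rintro _ ⟨l, -, rfl⟩
      exact hX _ hk _ (hsX _) _ (hy l)
    · obtain ⟨d, rfl⟩ := Nat.exists_eq_add_of_le hm
      -- the rank `i + d` is congruent to `i + d % (k + 1)` modulo the period `k + 1`
      refine ⟨y (d % (k + 1)), ⟨_, Nat.mod_lt _ k.succ_pos, rfl⟩, ?_⟩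
      have hinc : s (i + d % (k + 1)) ≤ s (i + d % (k + 1) + (k + 1)) := by
        obtain ⟨t', ht', hle'⟩ := (hgm (d % (k + 1))).exists_le hle (hstep i (d % (k + 1)))
        rw [Part.mem_unique ht' (hstep _ _)] at hle'
        rwa [show i + d % (k + 1) + (k + 1) = i + k + 1 + d % (k + 1) by ring]
      refine iter_le_of_mem_accel (n := d / (k + 1)) hS (hgm _) (hstep _ _) hinc (hy _) ?_
      rw [iter_iter]
      have h := hstep (i + d % (k + 1)) ((k + 1) * (d / (k + 1)))
      rwa [add_assoc, Nat.mod_add_div, Part.mem_unique (hs _) ht] at h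

end Dominate

/-! ### Bounded languages -/

section Bounded

variable {α : Type u}

lemma mem_kstar_singleton {w v : List α} :
    v ∈ KStar.kstar ({w} : Language α) ↔ ∃ n : ℕ, v = (List.replicate n w).flatten := by
  rw [Language.mem_kstar]
  constructor
  · rintro ⟨L, rfl, hL⟩
    exact ⟨L.length, by rw [← List.eq_replicate_of_mem hL]⟩
  · rintro ⟨n, rfl⟩
    exact ⟨_, rfl, fun y hy => List.eq_of_mem_replicate hy⟩

lemma mem_boundedLanguage_nil {v : List α} : v ∈ boundedLanguage ([] : List (List α)) ↔ v = [] :=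
  Iff.rfl

lemma boundedLanguage_append (ws ws' : List (List α)) :
    boundedLanguage (ws ++ ws') = boundedLanguage ws * boundedLanguage ws' := by
  simp [boundedLanguage]

lemma boundedLanguage_singleton (w : List α) :
    boundedLanguage [w] = KStar.kstar ({w} : Language α) := by
  simp [boundedLanguage]

lemma boundedLanguage_cons (w : List α) (ws : List (List α)) :
    boundedLanguage (w :: ws) = KStar.kstar ({w} : Language α) * boundedLanguage ws := by
  simp [boundedLanguage]

lemma mem_boundedLanguage_cons {w v : List α} {ws : List (List α)} :
    v ∈ boundedLanguage (w :: ws) ↔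
      ∃ n : ℕ, ∃ v' ∈ boundedLanguage ws, v = (List.replicate n w).flatten ++ v' := by
  rw [boundedLanguage_cons, Language.mem_mul]
  constructor
  · rintro ⟨a, ha, b, hb, rfl⟩
    obtain ⟨n, rfl⟩ := mem_kstar_singleton.1 ha
    exact ⟨n, b, hb, rfl⟩
  · rintro ⟨n, b, hb, rfl⟩
    exact ⟨_, mem_kstar_singleton.2 ⟨n, rfl⟩, b, hb, rfl⟩

lemma nil_mem_boundedLanguage (ws : List (List α)) : [] ∈ boundedLanguage ws := by
  induction ws with
  | nil => exact mem_boundedLanguage_nil.2 rfl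
  | cons w ws ih => exact mem_boundedLanguage_cons.2 ⟨0, [], ih, rfl⟩

lemma mem_boundedLanguage_of_mem {w : List α} {ws : List (List α)} (hw : w ∈ ws) :
    w ∈ boundedLanguage ws := by
  induction ws with
  | nil => simp at hw
  | cons w' ws ih =>
    rw [mem_boundedLanguage_cons]
    rcases List.mem_cons.1 hw with rfl | hw
    · exact ⟨1, [], nil_mem_boundedLanguage ws, by simp⟩
    · exact ⟨0, w, ih hw, rfl⟩

lemma map_mem_boundedLanguage {β : Type u} (σ : α → β) {v : List α} {ws : List (List α)}
    (hv : v ∈ boundedLanguage ws) : v.map σ ∈ boundedLanguage (ws.map (List.map σ)) := by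
  induction ws generalizing v with
  | nil => simpa [mem_boundedLanguage_nil] using hv
  | cons w ws ih =>
    obtain ⟨n, v', hv', rfl⟩ := mem_boundedLanguage_cons.1 hv
    exact mem_boundedLanguage_cons.2 ⟨n, v'.map σ, ih hv', by simp [List.map_flatten]⟩

lemma prefix_append_cases {v x y : List α} (h : v <+: x ++ y) :
    v <+: x ∨ ∃ t, t <+: y ∧ v = x ++ t := by
  rcases List.prefix_or_prefix_of_prefix h (List.prefix_append x y) with h' | ⟨t, rfl⟩
  · exact .inl h'
  · exact .inr ⟨t, (List.prefix_append_right_inj x).1 h, rfl⟩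

lemma prefix_flatten_replicate {v w : List α} {n : ℕ} (h : v <+: (List.replicate n w).flatten) :
    ∃ m : ℕ, ∃ p, p <+: w ∧ v = (List.replicate m w).flatten ++ p := by
  induction n generalizing v with
  | zero => exact ⟨0, [], List.nil_prefix, by simpa using h⟩
  | succ n ih =>
    rw [List.replicate_succ, List.flatten_cons] at h
    rcases prefix_append_cases h with h | ⟨t, ht, rfl⟩
    · exact ⟨0, v, h, rfl⟩
    · obtain ⟨m, p, hp, rfl⟩ := ih ht
      exact ⟨m + 1, p, hp, by simp [List.replicate_succ]⟩

/-- The prefixes of the words of `w₁* ⋯ w_k*` belong to a bounded language too: between `wᵢ*` and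
`wᵢ₊₁*`, insert `p*` for all the prefixes `p` of `wᵢ`. -/
lemma exists_prefixes_subset_boundedLanguage (ws : List (List α)) :
    ∃ ws' : List (List α), ∀ v ∈ prefixes (boundedLanguage ws), v ∈ boundedLanguage ws' := by
  induction ws with
  | nil =>
    refine ⟨[], ?_⟩
    rintro v ⟨w, hw, hv⟩
    rw [mem_boundedLanguage_nil.1 hw] at hv
    exact mem_boundedLanguage_nil.2 (List.prefix_nil.1 hv)
  | cons w ws ih =>
    obtain ⟨ws', h⟩ := ih
    refine ⟨w :: (w.inits ++ ws'), ?_⟩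
    rintro v ⟨x, hx, hv⟩
    obtain ⟨n, u, hu, rfl⟩ := mem_boundedLanguage_cons.1 hx
    rw [mem_boundedLanguage_cons, boundedLanguage_append]
    rcases prefix_append_cases hv with hv | ⟨t, ht, rfl⟩
    · obtain ⟨m, p, hp, rfl⟩ := prefix_flatten_replicate hv
      refine ⟨m, p, Language.mem_mul.2 ⟨p, mem_boundedLanguage_of_mem ?_, [],
        nil_mem_boundedLanguage _, by simp⟩, rfl⟩
      exact (List.mem_inits _ _).2 hp
    · exact ⟨n, t, Language.mem_mul.2 ⟨[], nil_mem_boundedLanguage _, t, h t ⟨u, hu, ht⟩, rfl⟩, rfl⟩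

end Bounded

/-! ### Regularity of bounded languages and rl-automata -/

section Regular

variable {α : Type u}

/-- `L` is the union of some members of the family `𝓕`. -/
def IsUnionFrom (𝓕 : Set (Language α)) (L : Language α) : Prop :=
  ∃ 𝓖 ⊆ 𝓕, ∀ v, v ∈ L ↔ ∃ K ∈ 𝓖, v ∈ K

lemma isUnionFrom_of_mem {𝓕 : Set (Language α)} {L : Language α} (hL : L ∈ 𝓕) :
    IsUnionFrom 𝓕 L :=
  ⟨{L}, by simpa using hL, by simp⟩

lemma isUnionFrom_of_forall_notMem {𝓕 : Set (Language α)} {L : Language α} (hL : ∀ v, v ∉ L) :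
    IsUnionFrom 𝓕 L :=
  ⟨∅, Set.empty_subset _, by simpa using hL⟩

lemma IsUnionFrom.union {𝓕 : Set (Language α)} {L L₁ L₂ : Language α} (h₁ : IsUnionFrom 𝓕 L₁)
    (h₂ : IsUnionFrom 𝓕 L₂) (h : ∀ v, v ∈ L ↔ v ∈ L₁ ∨ v ∈ L₂) : IsUnionFrom 𝓕 L := by
  obtain ⟨𝓖₁, hs₁, h₁⟩ := h₁
  obtain ⟨𝓖₂, hs₂, h₂⟩ := h₂
  refine ⟨𝓖₁ ∪ 𝓖₂, Set.union_subset hs₁ hs₂, fun v => ?_⟩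
  rw [h, h₁, h₂]
  simp only [Set.mem_union]
  grind

/-- A language is regular if it is a union of members of a finite family of languages whose left
quotients by letters are again unions of members of the family. -/
lemma isRegular_of_finite_family {L : Language α} {𝓕 : Set (Language α)} (hfin : 𝓕.Finite)
    (hL : IsUnionFrom 𝓕 L) (hstep : ∀ K ∈ 𝓕, ∀ a, IsUnionFrom 𝓕 (K.leftQuotient [a])) :
    L.IsRegular := by
  let U : Set (Language α) → Language α := fun 𝓖 => {v | ∃ K ∈ 𝓖, v ∈ K}
  refine Language.IsRegular.of_finite_range_leftQuotient ((hfin.finite_subsets.image U).subset ?_)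
  rintro _ ⟨x, rfl⟩
  suffices h : IsUnionFrom 𝓕 (L.leftQuotient x) by
    obtain ⟨𝓖, h𝓖, h⟩ := h
    exact ⟨𝓖, h𝓖, Language.ext fun v => (h v).symm⟩
  induction x using List.reverseRecOn with
  | nil => exact hL
  | append_singleton x a ih =>
    obtain ⟨𝓖, h𝓖, h⟩ := ih
    choose! q hq hqK using fun K hK => hstep K hK a
    refine ⟨⋃ K ∈ 𝓖, q K, Set.iUnion₂_subset fun K hK => hq K (h𝓖 hK), fun v => ?_⟩
    rw [Language.leftQuotient_append, Language.mem_leftQuotient, h]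
    simp only [Set.mem_iUnion]
    constructor
    · rintro ⟨K, hK, hv⟩
      obtain ⟨M, hM, hvM⟩ := (hqK K (h𝓖 hK) v).1 hv
      exact ⟨M, ⟨K, hK, hM⟩, hvM⟩
    · rintro ⟨M, ⟨K, hK, hM⟩, hvM⟩
      exact ⟨K, hK, (hqK K (h𝓖 hK) v).2 ⟨M, hM, hvM⟩⟩

/-- The left quotients of `w* M` are unions of left quotients of `M` and of the languages
`u w* M`, for the suffixes `u` of `w`. -/
lemma isRegular_kstar_singleton_mul (w : List α) {M : Language α} (hM : M.IsRegular) :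
    (KStar.kstar ({w} : Language α) * M).IsRegular := by
  set L := KStar.kstar ({w} : Language α) * M
  have hLmem : ∀ v, v ∈ L ↔ ∃ n : ℕ, ∃ b ∈ M, v = (List.replicate n w).flatten ++ b := by
    intro v
    rw [Language.mem_mul]
    constructor
    · rintro ⟨a, ha, b, hb, rfl⟩
      obtain ⟨n, rfl⟩ := mem_kstar_singleton.1 ha
      exact ⟨n, b, hb, rfl⟩
    · rintro ⟨n, b, hb, rfl⟩
      exact ⟨_, mem_kstar_singleton.2 ⟨n, rfl⟩, b, hb, rfl⟩
  let P : List α → Language α := fun u => {v | ∃ v' ∈ L, v = u ++ v'}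
  have hPmem : ∀ u v, v ∈ P u ↔ ∃ v' ∈ L, v = u ++ v' := fun u v => Iff.rfl
  have hPnil : P [] = L := Language.ext fun v => by simp [hPmem]
  have hLcases : ∀ v, v ∈ L ↔ v ∈ M ∨ v ∈ P w := by
    refine fun v => ⟨fun hv => ?_, ?_⟩
    · obtain ⟨n, b, hb, rfl⟩ := (hLmem v).1 hv
      rcases n with _ | n
      · exact .inl hb
      · exact .inr ⟨_, (hLmem _).2 ⟨n, b, hb, rfl⟩, by simp [List.replicate_succ]⟩
    · rintro (hv | ⟨v', hv', rfl⟩)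
      · exact (hLmem v).2 ⟨0, v, hv, rfl⟩
      · obtain ⟨n, b, hb, rfl⟩ := (hLmem v').1 hv'
        exact (hLmem _).2 ⟨n + 1, b, hb, by simp [List.replicate_succ]⟩
  set 𝓕 : Set (Language α) := P '' {u | u <:+ w} ∪ Set.range M.leftQuotient
  have hcons : ∀ (b : α) (u : List α), (b :: u) <:+ w → ∀ a,
      IsUnionFrom 𝓕 ((P (b :: u)).leftQuotient [a]) := by
    intro b u hu a
    by_cases hab : a = b
    · subst hab
      have h : (P (a :: u)).leftQuotient [a] = P u := Language.ext fun v => by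
        simp [Language.mem_leftQuotient, hPmem]
      rw [h]
      exact isUnionFrom_of_mem (.inl ⟨u, (List.suffix_cons a u).trans hu, rfl⟩)
    · exact isUnionFrom_of_forall_notMem fun v => by
        simp [Language.mem_leftQuotient, hPmem, hab]
  have hquot : ∀ x a, IsUnionFrom 𝓕 ((M.leftQuotient x).leftQuotient [a]) := fun x a => by
    rw [← Language.leftQuotient_append]
    exact isUnionFrom_of_mem (.inr ⟨_, rfl⟩)
  refine isRegular_of_finite_family (𝓕 := 𝓕) (Set.Finite.union ?_ hM.finite_range_leftQuotient)
    (isUnionFrom_of_mem (.inl ⟨[], List.nil_suffix, hPnil⟩)) ?_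
  · refine Set.Finite.image _ ((List.finite_toSet w.tails).subset fun u hu => ?_)
    exact (List.mem_tails _ _).2 hu
  · rintro _ (⟨u, hu, rfl⟩ | ⟨x, rfl⟩) a
    · rcases u with _ | ⟨b, u⟩
      · rw [hPnil]
        rcases w with _ | ⟨c, w⟩
        · -- if `w` is empty, then `w* M = M`
          have h : L = M := Language.ext fun v => by simp [hLmem]
          rw [h]
          exact hquot [] a
        · exact (hquot [] a).union (hcons c w List.suffix_rfl a) fun v => hLcases (a :: v)
      · exact hcons b u hu a
    · exact hquot x a

lemma isRegular_boundedLanguage (ws : List (List α)) : (boundedLanguage ws).IsRegular := by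
  induction ws with
  | nil =>
    refine isRegular_of_finite_family (Set.finite_singleton (boundedLanguage []))
      (isUnionFrom_of_mem rfl) ?_
    rintro _ rfl a
    exact isUnionFrom_of_forall_notMem fun v => by
      simp [Language.mem_leftQuotient, mem_boundedLanguage_nil]
  | cons w ws ih =>
    rw [boundedLanguage_cons]
    exact isRegular_kstar_singleton_mul w ih

lemma leftQuotient_prefixes (L : Language α) (x : List α) :
    (prefixes L).leftQuotient x = prefixes (L.leftQuotient x) := by
  refine Language.ext fun v => ?_
  constructor
  · rintro ⟨_, hw, t, rfl⟩
    exact ⟨v ++ t, by simpa [Language.mem_leftQuotient] using hw, List.prefix_append v t⟩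
  · rintro ⟨w, hw, hv⟩
    exact ⟨x ++ w, hw, (List.prefix_append_right_inj x).2 hv⟩

lemma isRegular_prefixes {L : Language α} (hL : L.IsRegular) : (prefixes L).IsRegular := by
  refine Language.IsRegular.of_finite_range_leftQuotient
    ((hL.finite_range_leftQuotient.image prefixes).subset ?_)
  rintro _ ⟨x, rfl⟩
  exact ⟨_, ⟨x, rfl⟩, (leftQuotient_prefixes L x).symm⟩

/-- A deterministic automaton for the prefixes of the words of a bounded language becomes an
rl-automaton once the transitions into non-final states are removed. -/
lemma exists_rlAutomaton (ws : List (List α)) :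
    ∃ 𝒜 : RLAutomaton α, ∀ w : List α,
      (w.foldlM 𝒜.δ 𝒜.q₀).isSome ↔ w ∈ prefixes (boundedLanguage ws) := by
  classical
  obtain ⟨σ, hσ, M, hM⟩ := isRegular_prefixes (isRegular_boundedLanguage ws)
  let δ : σ → α → Option σ := fun q a => if M.step q a ∈ M.accept then some (M.step q a) else none
  have hprefix : ∀ {v w : List α}, v <+: w → w ∈ M.accepts → v ∈ M.accepts := by
    rw [hM]
    rintro v w hvw ⟨u, hu, hwu⟩
    exact ⟨u, hu, hvw.trans hwu⟩
  have hrun : ∀ w : List α, w.foldlM δ M.start =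
      if w ∈ M.accepts then some (M.eval w) else none := by
    intro w
    induction w using List.reverseRecOn with
    | nil =>
      have : [] ∈ M.accepts := by
        rw [hM]
        exact ⟨[], nil_mem_boundedLanguage ws, List.nil_prefix⟩
      rw [if_pos this]
      rfl
    | append_singleton w a ih =>
      rw [List.foldlM_append, ih]
      by_cases hw : w ∈ M.accepts
      · rw [if_pos hw]
        have h : w ++ [a] ∈ M.accepts ↔ M.step (M.eval w) a ∈ M.accept := by
          rw [DFA.mem_accepts, DFA.eval_append_singleton]
        simp [δ, h]
      · have hwa : w ++ [a] ∉ M.accepts := fun h => hw (hprefix (List.prefix_append w [a]) h)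
        rw [if_neg hw, if_neg hwa]
        rfl
  have hrl : ∀ w : List α, (w.foldlM δ M.start).isSome ↔ w ∈ prefixes (boundedLanguage ws) := by
    intro w
    rw [hrun, ← hM]
    split_ifs with h <;> simp [h]
  exact ⟨⟨σ, Finite.of_fintype σ, δ, M.start, ws, hrl⟩, hrl⟩

end Regular

/-! ### Synchronized products are complete and flat -/

section Product

variable {S : Type u} [PartialOrder S] {Q : Type}

lemma ProdState.directedOn_image_state {D : Set (ProdState S Q)}
    (hD : DirectedOn (· ≤ ·) D) : DirectedOn (· ≤ ·) (ProdState.state '' D) :=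
  directedOn_image.2 (hD.mono fun _ _ h => h.1)

lemma ProdState.control_eq_of_isLUB {D : Set (ProdState S Q)} {p : ProdState S Q}
    (hp : IsLUB D p) : ∀ d ∈ D, d.control = p.control := fun _ hd => (hp.1 hd).2

lemma ProdState.isLUB_iff {D : Set (ProdState S Q)} (hne : D.Nonempty) {p : ProdState S Q}
    (hD : ∀ d ∈ D, d.control = p.control) :
    IsLUB D p ↔ IsLUB (ProdState.state '' D) p.state := by
  constructor
  · refine fun hp => ⟨?_, fun b hb => ?_⟩
    · rintro _ ⟨d, hd, rfl⟩
      exact (hp.1 hd).1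
    · exact (hp.2 (show (⟨b, p.control⟩ : ProdState S Q) ∈ upperBounds D from
        fun d hd => ⟨hb ⟨d, hd, rfl⟩, hD d hd⟩)).1
  · refine fun hp => ⟨fun d hd => ⟨hp.1 ⟨d, hd, rfl⟩, hD d hd⟩, fun b hb => ⟨hp.2 ?_, ?_⟩⟩
    · rintro _ ⟨d, hd, rfl⟩
      exact (hb hd).1
    · obtain ⟨d, hd⟩ := hne
      exact (hD d hd).symm.trans (hb hd).2

lemma ProdState.scottContinuous_state : ScottContinuous (ProdState.state : ProdState S Q → S) :=
  fun _ hne _ _ hp => (ProdState.isLUB_iff hne (ProdState.control_eq_of_isLUB hp)).1 hp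

lemma WayBelow.le {x y : S} (h : WayBelow x y) : x ≤ y := by
  obtain ⟨z, rfl, hz⟩ := h {y} (Set.singleton_nonempty y) (directedOn_singleton y) y
    isLUB_singleton le_rfl
  exact hz

/-- The way-below relation of `S × Q`, for a discrete `Q`, is that of `S` on each copy of `S`. -/
lemma ProdState.wayBelow_iff {p : ProdState S Q} {y : S} {q : Q} :
    WayBelow p ⟨y, q⟩ ↔ WayBelow p.state y ∧ p.control = q := by
  constructor
  · refine fun h => ⟨fun D hne hdir a ha hya => ?_, h.le.2⟩
    have himage : ProdState.state '' ((fun x => (⟨x, q⟩ : ProdState S Q)) '' D) = D := by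
      rw [Set.image_image]
      exact Set.image_id D
    obtain ⟨_, ⟨z, hz, rfl⟩, hle⟩ := h ((fun x => ⟨x, q⟩) '' D) (hne.image _)
      (directedOn_image.2 (hdir.mono fun _ _ h => ⟨h, rfl⟩)) ⟨a, q⟩
      ((ProdState.isLUB_iff (hne.image _) (by rintro _ ⟨z, -, rfl⟩; rfl)).2 (by rwa [himage]))
      ⟨hya, rfl⟩
    exact ⟨z, hz, hle.1⟩
  · rintro ⟨h, hq⟩ D hne hdir a ha hle
    have hctrl := ProdState.control_eq_of_isLUB ha
    obtain ⟨_, ⟨d, hd, rfl⟩, hz⟩ := h _ (hne.image _) (ProdState.directedOn_image_state hdir)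
      a.state ((ProdState.isLUB_iff hne hctrl).1 ha) hle.1
    exact ⟨d, hd, hz, hq.trans (hle.2.trans (hctrl d hd).symm)⟩

lemma ProdState.setOf_wayBelow (y : S) (q : Q) :
    {p : ProdState S Q | WayBelow p ⟨y, q⟩} = (fun x => ⟨x, q⟩) '' {x | WayBelow x y} := by
  ext ⟨x, q'⟩
  simp only [Set.mem_ofPred_eq, ProdState.wayBelow_iff, Set.mem_image, ProdState.mk.injEq]
  grind

lemma IsContinuousDcwo.prodState [Finite Q] (hS : IsContinuousDcwo S) :
    IsContinuousDcwo (ProdState S Q) where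
  dcpo D hne hdir := by
    obtain ⟨a, ha⟩ := hS.dcpo _ (hne.image _) (ProdState.directedOn_image_state hdir)
    obtain ⟨d₀, hd₀⟩ := hne
    refine ⟨⟨a, d₀.control⟩, (ProdState.isLUB_iff ⟨d₀, hd₀⟩ fun d hd => ?_).2 ha⟩
    obtain ⟨e, -, h, h₀⟩ := hdir d hd d₀ hd₀
    exact h.2.trans h₀.2.symm
  wpo := ⟨fun f => by
    obtain ⟨m, n, hmn, h⟩ := hS.wpo.wqo.prod (Finite.wellQuasiOrdered (α := Q) (· = ·))
      fun n => ((f n).state, (f n).control)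
    exact ⟨m, n, hmn, h⟩⟩
  nonempty := by
    rintro ⟨y, q⟩
    rw [ProdState.setOf_wayBelow]
    exact (hS.nonempty y).image _
  directed := by
    rintro ⟨y, q⟩
    rw [ProdState.setOf_wayBelow]
    exact directedOn_image.2 ((hS.directed y).mono fun _ _ h => ⟨h, rfl⟩)
  isLUB := by
    rintro ⟨y, q⟩
    rw [ProdState.setOf_wayBelow,
      ProdState.isLUB_iff ((hS.nonempty y).image _) (by rintro _ ⟨z, -, rfl⟩; rfl),
      Set.image_image]
    simpa using hS.isLUB y

variable {T : FTS S}

lemma mem_bowtie {S : Type u} {T : FTS S} {δ : Q → T.F → Option Q} {f : T.F}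
    {p p' : ProdState S Q} : p' ∈ bowtie δ f p ↔
      p'.state ∈ f.1 p.state ∧ δ p.control f = some p'.control := by
  constructor
  · intro h
    obtain ⟨s', hs', h⟩ := Part.mem_bind_iff.1 h
    obtain ⟨q', hq', rfl⟩ := (Part.mem_map_iff _).1 h
    exact ⟨hs', Part.mem_ofOption.1 hq'⟩
  · rintro ⟨hs, hq⟩
    exact Part.mem_bind_iff.2 ⟨_, hs, (Part.mem_map_iff _).2 ⟨_, Part.mem_ofOption.2 hq, rfl⟩⟩

lemma partialContinuous_bowtie (δ : Q → T.F → Option Q) {f : T.F} (hf : PartialContinuous f.1) :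
    PartialContinuous (bowtie δ f) := by
  have hdom : ∀ p, p ∈ (bowtie δ f).Dom ↔ p.state ∈ f.1.Dom ∧ ∃ q, δ p.control f = some q := by
    intro p
    rw [PFun.mem_dom, PFun.mem_dom]
    constructor
    · rintro ⟨p', hp'⟩
      exact ⟨⟨_, (mem_bowtie.1 hp').1⟩, _, (mem_bowtie.1 hp').2⟩
    · rintro ⟨⟨s, hs⟩, q, hq⟩
      exact ⟨⟨s, q⟩, mem_bowtie.2 ⟨hs, hq⟩⟩
  have hclosed := isOpen_scott_iff.1 hf.1
  refine ⟨isOpen_scott_iff.2 ⟨?_, ?_⟩, ?_⟩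
  · intro p p' hle hp h
    rw [hdom] at h
    exact hp ((hdom p).2 ⟨hf.monotonic.1 hle.1 h.1, by rw [← hle.2]; exact h.2⟩)
  · intro D hD hne hdir a ha h
    rw [hdom] at h
    refine hclosed.2 ?_ (hne.image _) (ProdState.directedOn_image_state hdir)
      ((ProdState.isLUB_iff hne (ProdState.control_eq_of_isLUB ha)).1 ha) h.1
    rintro _ ⟨d, hd, rfl⟩ hd'
    exact hD hd ((hdom d).2 ⟨hd', by rw [ProdState.control_eq_of_isLUB ha d hd]; exact h.2⟩)
  · intro D hD hne hdir a ha
    have hctrl := ProdState.control_eq_of_isLUB ha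
    have hD' : ProdState.state '' D ⊆ f.1.Dom := by
      rintro _ ⟨d, hd, rfl⟩
      exact ((hdom d).1 (hD hd)).1
    obtain ⟨b, hb, hlub⟩ := hf.2 _ hD' (hne.image _) (ProdState.directedOn_image_state hdir) _
      ((ProdState.isLUB_iff hne hctrl).1 ha)
    obtain ⟨d₀, hd₀⟩ := hne
    obtain ⟨-, q, hq⟩ := (hdom d₀).1 (hD hd₀)
    rw [hctrl d₀ hd₀] at hq
    refine ⟨⟨b, q⟩, mem_bowtie.2 ⟨hb, hq⟩, ?_⟩
    have himage : ProdState.state '' (bowtie δ f).image D = f.1.image (ProdState.state '' D) := by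
      ext s
      constructor
      · rintro ⟨p', ⟨p, hp, hpp⟩, rfl⟩
        exact ⟨p.state, ⟨p, hp, rfl⟩, (mem_bowtie.1 hpp).1⟩
      · rintro ⟨_, ⟨p, hp, rfl⟩, hs⟩
        exact ⟨⟨s, q⟩, ⟨p, hp, mem_bowtie.2 ⟨hs, by rw [hctrl p hp, hq]⟩⟩, rfl⟩
    refine (ProdState.isLUB_iff ?_ ?_).2 (by rwa [himage])
    · obtain ⟨p', hp'⟩ := (PFun.mem_dom _ _).1 (hD hd₀)
      exact ⟨p', d₀, hd₀, hp'⟩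
    · rintro p' ⟨p, hp, hpp⟩
      have h := (mem_bowtie.1 hpp).2
      rw [hctrl p hp, hq] at h
      exact (Option.some.inj h).symm

lemma FTS.IsComplete.syncProduct (hT : T.IsComplete) (𝒜 : RLAutomaton T.F) :
    (syncProduct T 𝒜).IsComplete where
  dcwo := by
    have := 𝒜.finite
    exact hT.dcwo.prodState
  continuous := by
    rintro _ ⟨f, -, rfl⟩
    exact partialContinuous_bowtie 𝒜.δ (hT.continuous f.1 f.2)

lemma reflTransGen_syncProduct {S : Type u} {T : FTS S} {𝒜 : RLAutomaton T.F} {w : List T.F}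
    {s t : S} {q q' : 𝒜.Q}
    (ht : t ∈ T.run w s) (hq : w.foldlM 𝒜.δ q = some q') :
    Relation.ReflTransGen (syncProduct T 𝒜).Step ⟨s, q⟩ ⟨t, q'⟩ := by
  induction w generalizing s q with
  | nil =>
    rw [FTS.mem_run_nil.1 ht]
    rw [List.foldlM_nil] at hq
    rw [Option.some.inj hq]
  | cons f w ih =>
    obtain ⟨s', hs', hst⟩ := FTS.mem_run_cons.1 ht
    rw [List.foldlM_cons] at hq
    obtain ⟨r, hr, hrq⟩ := Option.bind_eq_some_iff.1 hq
    exact .head (b := ⟨s', r⟩) ⟨bowtie 𝒜.δ f, ⟨f, ⟨q, by rw [hr]; rfl⟩, rfl⟩,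
      mem_bowtie.2 ⟨hs', hr⟩⟩ (ih hst hrq)

lemma step_of_syncProduct_step {S : Type u} {T : FTS S} {𝒜 : RLAutomaton T.F}
    {p p' : ProdState S 𝒜.Q} (h : (syncProduct T 𝒜).Step p p') : T.Step p.state p'.state := by
  obtain ⟨_, ⟨f, -, rfl⟩, h⟩ := h
  exact ⟨f.1, f.2, (mem_bowtie.1 h).1⟩

/-- The first projection maps the closed cover of a synchronized product into that of `T`. -/
lemma cl_image_state_subset (T : FTS S) (𝒜 : RLAutomaton T.F) (s₀ : S) :
    cl (ProdState.state '' cl ((syncProduct T 𝒜).Cover ⟨s₀, 𝒜.q₀⟩)) ⊆ cl (T.Cover s₀) := by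
  refine cl_subset (scottClosed_cl _) (Set.image_subset_iff.2 ?_)
  refine cl_subset ((scottClosed_cl _).preimage ProdState.scottContinuous_state) ?_
  rintro p ⟨p₀, hp₀, p', hpp, hle⟩
  refine subset_cl _ ⟨p₀.state, hp₀.1, p'.state, ?_, hle.1⟩
  exact hpp.lift ProdState.state fun _ _ h => step_of_syncProduct_step h

/-- A choice of a transition of `T` underlying each transition of a synchronized product. Distinct
transitions of `T` may well induce the same transition of the product. -/
noncomputable def baseTransition {S : Type u} (T : FTS S) (𝒜 : RLAutomaton T.F)
    (h : (syncProduct T 𝒜).F) : T.F := h.2.choose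

lemma bowtie_baseTransition {S : Type u} {T : FTS S} {𝒜 : RLAutomaton T.F}
    (h : (syncProduct T 𝒜).F) : bowtie 𝒜.δ (baseTransition T 𝒜 h) = h.1 := h.2.choose_spec.2.symm

lemma foldlM_map_baseTransition {S : Type u} {T : FTS S} {𝒜 : RLAutomaton T.F}
    {w : List (syncProduct T 𝒜).F} {p p' : ProdState S 𝒜.Q} (h : p' ∈ (syncProduct T 𝒜).run w p) :
    (w.map (baseTransition T 𝒜)).foldlM 𝒜.δ p.control = some p'.control := by
  induction w generalizing p with
  | nil => rw [FTS.mem_run_nil.1 h]; rfl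
  | cons f w ih =>
    obtain ⟨r, hr, hrp⟩ := FTS.mem_run_cons.1 h
    rw [← bowtie_baseTransition f] at hr
    rw [List.map_cons, List.foldlM_cons, (mem_bowtie.1 hr).2]
    exact ih hrp

lemma isFlat_syncProduct {S : Type u} (T : FTS S) (𝒜 : RLAutomaton T.F) (s : S) :
    (syncProduct T 𝒜).IsFlat ⟨s, 𝒜.q₀⟩ := by
  obtain ⟨ws, hws⟩ := 𝒜.isRL
  obtain ⟨ws', hws'⟩ := exists_prefixes_subset_boundedLanguage ws
  by_cases hne : Nonempty (syncProduct T 𝒜).F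
  · -- `σ` recovers the transitions of the product from the underlying transitions of `T`
    obtain ⟨σ, hσ⟩ : ∃ σ : T.F → (syncProduct T 𝒜).F, ∀ h, σ (baseTransition T 𝒜 h) = h := by
      refine (Function.Injective.hasLeftInverse (f := baseTransition T 𝒜) fun h h' heq => ?_)
      refine Subtype.ext ?_
      rw [← bowtie_baseTransition h, ← bowtie_baseTransition h', heq]
    refine ⟨ws'.map (List.map σ), fun w hw => ?_⟩
    obtain ⟨p, hp⟩ := Part.dom_iff_mem.1 hw
    have h := foldlM_map_baseTransition hp
    have hmem := map_mem_boundedLanguage σ (hws' _ ((hws _).1 (by rw [h]; rfl)))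
    rwa [List.map_map, show σ ∘ baseTransition T 𝒜 = id from funext hσ, List.map_id] at hmem
  · refine ⟨[], fun w _ => ?_⟩
    rcases w with _ | ⟨f, w⟩
    · exact nil_mem_boundedLanguage []
    · exact (hne ⟨f⟩).elim

end Product

/-! ### Flattenings force termination -/

section Equivalences

variable {S : Type u} [PartialOrder S] {T : FTS S} {s₀ : S}

lemma AccelClosed.exists_finite_reachBy_le {X : Set S} (hX : AccelClosed T X) (hT : T.IsComplete)
    (ws : List (List T.F)) {a : S} (ha : a ∈ X) :
    ∃ A ⊆ X, A.Finite ∧ ∀ t ∈ T.reachBy (boundedLanguage ws) a, ∃ b ∈ A, t ≤ b := by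
  induction ws generalizing a with
  | nil =>
    refine ⟨{a}, by simpa using ha, Set.finite_singleton a, ?_⟩
    rintro t ⟨v, hv, ht⟩
    rw [mem_boundedLanguage_nil.1 hv] at ht
    exact ⟨a, rfl, (FTS.mem_run_nil.1 ht).le⟩
  | cons w ws ih =>
    obtain ⟨A, hAX, hA, hdom⟩ := hX.exists_finite_iter_le hT (FTS.run_mem_compositions w) ha
    choose! B hBX hB hBdom using fun (b : S) (hb : b ∈ X) => ih hb
    refine ⟨⋃ b ∈ A, B b, Set.iUnion₂_subset fun b hb => hBX b (hAX hb),
      hA.biUnion fun b hb => hB b (hAX hb), ?_⟩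
    rintro t ⟨_, hu, ht⟩
    obtain ⟨n, v, hv, rfl⟩ := mem_boundedLanguage_cons.1 hu
    obtain ⟨s, hs, hst⟩ := FTS.mem_run_append.1 ht
    rw [← FTS.iter_run] at hs
    obtain ⟨b, hb, hsb⟩ := hdom n s hs
    obtain ⟨t', ht', htt⟩ := (hT.partialContinuous_run v).monotonic.exists_le hsb hst
    obtain ⟨c, hc, htc⟩ := hBdom b (hAX hb) t' ⟨v, hv, ht'⟩
    exact ⟨c, Set.mem_biUnion hb hc, htt.trans htc⟩

lemma IsContinuousFlattening.mem_run {S₁ : Type u} [PartialOrder S₁] {T₁ : FTS S₁} {s₁ : S₁}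
    {φ : S₁ → S} {ψ : T₁.F → T.F} (hφ : IsContinuousFlattening T₁ s₁ T φ ψ) {w : List T₁.F}
    {s t : S₁} (ht : t ∈ T₁.run w s) : φ t ∈ T.run (w.map ψ) (φ s) := by
  induction w generalizing s with
  | nil => rw [FTS.mem_run_nil.1 ht]; exact Part.mem_some _
  | cons f w ih =>
    obtain ⟨r, hr, hrt⟩ := FTS.mem_run_cons.1 ht
    exact FTS.mem_run_cons.2 ⟨φ r, hφ.morphism _ _ f hr, ih hrt⟩

/-- If `(T, s₀)` is weakly clover-flattable, then the closed cover of `s₀` is dominated by finitely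
many elements of any acceleration-closed set that contains `s₀`. -/
lemma WeaklyCloverFlattable.exists_finite_cl_Cover_le (hT : T.IsComplete)
    (h : WeaklyCloverFlattable T s₀) {X : Set S} (hX : AccelClosed T X) (hs₀ : s₀ ∈ X) :
    ∃ A ⊆ X, A.Finite ∧ ∀ t ∈ cl (T.Cover s₀), ∃ b ∈ A, t ≤ b := by
  obtain ⟨S₁, _, T₁, s₁, φ, ψ, hφ, hs, hcl⟩ := h
  obtain ⟨ws, hws⟩ := hφ.flat
  obtain ⟨A, hAX, hA, hdom⟩ := hX.exists_finite_reachBy_le hT (ws.map (List.map ψ)) hs₀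
  refine ⟨A, hAX, hA, ?_⟩
  have hclosed := scottClosed_lowerClosure hA
  refine hcl.trans (cl_subset hclosed (Set.image_subset_iff.2 ?_))
  refine cl_subset (hclosed.preimage hφ.continuous) fun t ht => ?_
  obtain ⟨w, t', ht', htt⟩ := hφ.complete.exists_run_of_mem_Cover ht
  have hw := map_mem_boundedLanguage ψ (hws w (Part.dom_iff_mem.2 ⟨t', ht'⟩))
  obtain ⟨u, hu, hle⟩ := (hT.partialContinuous_run (w.map ψ)).monotonic.exists_le hs
    (hφ.mem_run ht')
  obtain ⟨b, hb, hub⟩ := hdom u ⟨_, hw, hu⟩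
  exact ⟨b, hb, (hφ.continuous.monotone htt).trans (hle.trans hub)⟩

/-- Every value of the variable `A` of the procedure is contained in the closed cover. -/
lemma RunsFor.subset_cl_Cover (hT : T.IsComplete) {A : ℕ → Set S} {pick : ℕ → (S →. S) × S}
    {N : ℕ} (h : RunsFor T s₀ A pick N) : ∀ n ≤ N, A n ⊆ cl (T.Cover s₀) := by
  intro n
  induction n with
  | zero =>
    intro _
    rw [h.init, Set.singleton_subset_iff]
    exact subset_cl _ ⟨s₀, le_rfl, s₀, .refl, le_rfl⟩
  | succ n ih =>
    intro hn
    obtain ⟨y, hy, hA⟩ := h.update n hn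
    obtain ⟨hg, ha, -⟩ := h.choice n hn
    rw [hA]
    refine Set.insert_subset ?_ (ih (Nat.le_of_succ_le hn))
    refine (scottClosed_cl _).mem_of_mem_accel hT.dcwo.dcpo
      (hT.partialContinuous_of_mem_compositions hg).monotonic
      (orbit_subset_of_subset_core ?_ (ih (Nat.le_of_succ_le hn) ha)) hy
    obtain ⟨w, hw⟩ := hg
    rw [hw]
    exact FTS.subset_core_run (fun f hf => hT.cl_Cover_subset_core s₀ hf) w

/-- The union of the values of `A` in an infinite fair execution is acceleration-closed, so that
some value of `A` dominates the whole closed cover; but then the loop guard fails. -/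
lemma WeaklyCloverFlattable.cloverTerminates (hT : T.IsComplete)
    (h : WeaklyCloverFlattable T s₀) : CloverTerminates T s₀ := by
  rintro ⟨A, pick, hrun, hfair⟩
  have hmono : Monotone A := monotone_nat_of_le_succ fun n => by
    obtain ⟨y, -, hA⟩ := (hrun (n + 1)).update n n.lt_succ_self
    rw [hA]
    exact Set.subset_insert y (A n)
  have hX : AccelClosed T (⋃ n, A n) := by
    intro g hg a ha y hy
    obtain ⟨m, hm⟩ := Set.mem_iUnion.1 ha
    obtain ⟨n, -, hpick⟩ := hfair m g hg a hm (accel_dom.1 (Part.dom_iff_mem.2 ⟨y, hy⟩))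
    obtain ⟨y', hy', hA⟩ := (hrun (n + 1)).update n n.lt_succ_self
    rw [hpick] at hy'
    refine Set.mem_iUnion.2 ⟨n + 1, ?_⟩
    rw [hA, Part.mem_unique hy hy']
    exact Set.mem_insert _ _
  have hs₀ : s₀ ∈ ⋃ n, A n := Set.mem_iUnion.2 ⟨0, by rw [(hrun 0).init]; rfl⟩
  obtain ⟨B, hBX, hB, hdom⟩ := h.exists_finite_cl_Cover_le hT hX hs₀
  obtain ⟨m, hm⟩ := hmono.directed_le.exists_mem_subset_of_finset_subset_biUnion
    (s := hB.toFinset) (by simpa using hBX)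
  refine (hrun (m + 1)).guard m m.lt_succ_self ?_
  rintro t ⟨s, hs, f, hf, hst⟩
  have hsC := (hrun m).subset_cl_Cover hT m le_rfl hs
  obtain ⟨b, hb, htb⟩ := hdom t (hT.cl_Cover_subset_core s₀ hf hsC hst)
  exact ⟨b, hm (by simpa using hb), htb⟩

/-! ### An execution that exits yields an rl-automaton -/

/-- The states computed by the procedure lie in the closure of the set of states reached from `s₀`
by the words of `w₀* w₁* ⋯`, where `wᵢ` is a word for the composition chosen in turn `i`. -/
lemma RunsFor.exists_boundedLanguage (hT : T.IsComplete) {A : ℕ → Set S}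
    {pick : ℕ → (S →. S) × S} {N : ℕ} (h : RunsFor T s₀ A pick N) (n : ℕ) (hn : n ≤ N) :
    ∃ ws, A n ⊆ cl (T.reachBy (boundedLanguage ws) s₀) := by
  induction n with
  | zero =>
    refine ⟨[], ?_⟩
    rw [h.init, Set.singleton_subset_iff]
    exact subset_cl _ ⟨[], nil_mem_boundedLanguage [], Part.mem_some _⟩
  | succ n ih =>
    obtain ⟨ws, hws⟩ := ih (Nat.le_of_succ_le hn)
    obtain ⟨y, hy, hA⟩ := h.update n hn
    obtain ⟨⟨w, hw⟩, ha, -⟩ := h.choice n hn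
    rw [hw] at hy
    -- appending `wᵏ` to a word of the previous language gives a word of the new one
    have hmem : ∀ v ∈ boundedLanguage ws, ∀ k : ℕ,
        v ++ (List.replicate k w).flatten ∈ boundedLanguage (ws ++ [w]) := fun v hv k => by
      rw [boundedLanguage_append, boundedLanguage_singleton]
      exact Language.mem_mul.2 ⟨v, hv, _, mem_kstar_singleton.2 ⟨k, rfl⟩, rfl⟩
    refine ⟨ws ++ [w], ?_⟩
    have hiter : ∀ k, cl (T.reachBy (boundedLanguage ws) s₀) ⊆
        (iter (T.run w) k).core (cl (T.reachBy (boundedLanguage (ws ++ [w])) s₀)) := fun k => by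
      refine cl_subset (((hT.partialContinuous_run w).iter k).scottClosed_core
        (scottClosed_cl _)) ?_
      rintro t ⟨v, hv, ht⟩ t' ht'
      rw [FTS.iter_run] at ht'
      exact subset_cl _ ⟨_, hmem v hv k, FTS.mem_run_append.2 ⟨t, ht, ht'⟩⟩
    rw [hA]
    refine Set.insert_subset ?_ fun a ha => hiter 0 (hws ha) (Part.mem_some a)
    refine (scottClosed_cl _).mem_of_mem_accel hT.dcwo.dcpo (hT.partialContinuous_run w).monotonic
      ?_ hy
    rintro t ⟨k, ht⟩
    exact hiter k (hws ha) ht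

lemma CloverCanTerminate.stronglyCloverFlattable (hT : T.IsComplete)
    (h : CloverCanTerminate T s₀) : StronglyCloverFlattable T s₀ := by
  obtain ⟨A, pick, N, hrun, hexit⟩ := h
  obtain ⟨ws, hws⟩ := hrun.exists_boundedLanguage hT N le_rfl
  obtain ⟨𝒜, h𝒜⟩ := exists_rlAutomaton ws
  refine ⟨𝒜, subset_antisymm (cl_subset (scottClosed_cl _) ?_) (cl_image_state_subset T 𝒜 s₀)⟩
  set C := cl (ProdState.state '' cl ((syncProduct T 𝒜).Cover ⟨s₀, 𝒜.q₀⟩))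
  have hreach : cl (T.reachBy (boundedLanguage ws) s₀) ⊆ C := by
    refine cl_subset (scottClosed_cl _) ?_
    rintro t ⟨v, hv, ht⟩
    obtain ⟨q, hq⟩ := Option.isSome_iff_exists.1 ((h𝒜 v).2 ⟨v, hv, List.prefix_rfl⟩)
    exact subset_cl _ ⟨⟨t, q⟩, subset_cl _
      ⟨_, le_rfl, _, reflTransGen_syncProduct ht hq, le_rfl⟩, rfl⟩
  -- when the loop is exited, the downward closure of `A N` is stable under the transitions
  have hs₀ : s₀ ∈ A N := by
    have hall : ∀ n ≤ N, s₀ ∈ A n := by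
      intro n
      induction n with
      | zero => exact fun _ => by rw [hrun.init]; rfl
      | succ n ih =>
        intro hn
        obtain ⟨y, -, hA⟩ := hrun.update n hn
        rw [hA]
        exact Set.mem_insert_of_mem y (ih (Nat.le_of_succ_le hn))
    exact hall N le_rfl
  have hstable : ∀ f ∈ T.F, {x | ∃ a ∈ A N, x ≤ a} ⊆ f.core {x | ∃ a ∈ A N, x ≤ a} := by
    rintro f hf x ⟨a, ha, hxa⟩ y hy
    obtain ⟨b, hb, hyb⟩ := (hT.continuous f hf).monotonic.exists_le hxa hy
    obtain ⟨c, hc, hbc⟩ := hexit b ⟨a, ha, f, hf, hb⟩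
    exact ⟨c, hc, hyb.trans hbc⟩
  intro t ht
  obtain ⟨w, t', ht', htt⟩ := hT.exists_run_of_mem_Cover ht
  obtain ⟨a, ha, hta⟩ := FTS.subset_core_run hstable w ⟨s₀, hs₀, le_rfl⟩ ht'
  exact (scottClosed_cl _).1 (htt.trans hta) (hreach (hws ha))

/-! ### Comparison of the notions of flattability -/

lemma StronglyCloverFlattable.cloverFlattable (hT : T.IsComplete)
    (h : StronglyCloverFlattable T s₀) : CloverFlattable T s₀ := by
  obtain ⟨𝒜, h𝒜⟩ := h
  refine ⟨ProdState S 𝒜.Q, inferInstance, syncProduct T 𝒜, ⟨s₀, 𝒜.q₀⟩, ProdState.state,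
    baseTransition T 𝒜, ⟨hT.syncProduct 𝒜, isFlat_syncProduct T 𝒜 s₀, fun p p' h hp => ?_,
      ProdState.scottContinuous_state⟩, rfl, h𝒜⟩
  rw [← bowtie_baseTransition h] at hp
  exact (mem_bowtie.1 hp).1

lemma CloverFlattable.weaklyCloverFlattable (h : CloverFlattable T s₀) :
    WeaklyCloverFlattable T s₀ := by
  obtain ⟨S₁, _, T₁, s₁, φ, ψ, hφ, hs, hcl⟩ := h
  exact ⟨S₁, _, T₁, s₁, φ, ψ, hφ, hs.le, hcl.subset⟩

/-! ### Fair scheduling -/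

/-- If no execution exits the loop, then a fair scheduler of the countably many compositions and
of the states computed so far, in their order of creation, yields an infinite fair execution. -/
lemma CloverTerminates.cloverCanTerminate (h : CloverTerminates T s₀) :
    CloverCanTerminate T s₀ := by
  by_contra hnot
  refine h ?_
  have : Finite T.F := T.finite
  obtain ⟨e, he⟩ := exists_surjective_nat (List T.F)
  -- turn `n` is assigned the composition of index `i` and the state of index `j`, where `n` codes
  -- `((i, j), m)`; the pair `(id, s₀)`, which is always available, is chosen if there is no state
  -- of index `j` yet or if it is not in the domain
  have hturn : ∀ (n : ℕ) (l : {l : List S // s₀ ∈ l}), ∃ (p : (S →. S) × S) (y : S),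
      p.1 ∈ T.compositions ∧ p.2 ∈ l.1 ∧ y ∈ accel p.1 p.2 ∧
        ∀ a, l.1[n.unpair.1.unpair.2]? = some a → (T.run (e n.unpair.1.unpair.1) a).Dom →
          p = (T.run (e n.unpair.1.unpair.1), a) := by
    rintro n ⟨l, hl⟩
    by_cases hcase : ∃ a, l[n.unpair.1.unpair.2]? = some a ∧
        (T.run (e n.unpair.1.unpair.1) a).Dom
    · obtain ⟨a, ha, hdom⟩ := hcase
      obtain ⟨y, hy⟩ := Part.dom_iff_mem.1 (accel_dom.2 hdom)
      refine ⟨(_, a), y, FTS.run_mem_compositions _, List.mem_of_getElem? ha, hy, fun b hb _ => ?_⟩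
      rw [Option.some.inj (ha.symm.trans hb)]
    · obtain ⟨y, hy⟩ := exists_mem_accel (g := T.run []) (Part.mem_some s₀)
      exact ⟨(_, s₀), y, FTS.run_mem_compositions _, hl, hy,
        fun a ha hdom => (hcase ⟨a, ha, hdom⟩).elim⟩
  choose p y hcomp hmem hy hfair using hturn
  let l : ℕ → {l : List S // s₀ ∈ l} := Nat.rec ⟨[s₀], List.mem_singleton_self s₀⟩
    fun n l => ⟨l.1 ++ [y n l], List.mem_append_left _ l.2⟩
  have hl : ∀ n, (l (n + 1)).1 = (l n).1 ++ [y n (l n)] := fun n => rfl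
  let A : ℕ → Set S := fun n => {x | x ∈ (l n).1}
  let pick : ℕ → (S →. S) × S := fun n => p n (l n)
  have hprefix : ∀ m k, (l m).1 <+: (l (m + k)).1 := by
    intro m k
    induction k with
    | zero => exact List.prefix_rfl
    | succ k ih =>
      rw [← add_assoc, hl]
      exact ih.trans (List.prefix_append _ _)
  refine ⟨A, pick, fun N => ?_, ?_⟩
  · induction N with
    | zero =>
      refine ⟨?_, by simp, by simp, by simp⟩
      ext x
      exact List.mem_singleton
    | succ N ih =>
      refine ⟨ih.init, fun n hn => ?_, fun n _ => ?_, fun n _ => ?_⟩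
      · rcases Nat.lt_succ_iff_lt_or_eq.1 hn with hn | rfl
        · exact ih.guard n hn
        · exact fun hdom => hnot ⟨A, pick, n, ih, hdom⟩
      · exact ⟨hcomp _ _, hmem _ _, accel_dom.1 (Part.dom_iff_mem.2 ⟨_, hy n (l n)⟩)⟩
      · refine ⟨_, hy n (l n), ?_⟩
        ext x
        change x ∈ (l (n + 1)).1 ↔ x = y n (l n) ∨ x ∈ (l n).1
        rw [hl, List.mem_append, List.mem_singleton, or_comm]
  · rintro m _ ⟨w, rfl⟩ a ha hdom
    obtain ⟨i, rfl⟩ := he w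
    obtain ⟨j, hj⟩ := List.getElem?_of_mem ha
    have hle := Nat.right_le_pair (Nat.pair i j) m
    refine ⟨Nat.pair (Nat.pair i j) m, hle, ?_⟩
    obtain ⟨k, hk⟩ := Nat.exists_eq_add_of_le hle
    have hget : (l (Nat.pair (Nat.pair i j) m)).1[j]? = some a := by
      obtain ⟨r, hr⟩ := hprefix m k
      rw [hk, ← hr]
      exact List.getElem?_append_left (List.getElem?_eq_some_iff.1 hj).1 |>.trans hj
    have h := hfair (Nat.pair (Nat.pair i j) m) (l (Nat.pair (Nat.pair i j) m)) a
    simp only [Nat.unpair_pair] at h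
    exact h hget hdom

end Equivalences

end WSTS

/-! ### Equivalence of flattability and termination -/

theorem mainTheorem1 {S : Type*} [PartialOrder S] (T : WSTS.FTS S) (hT : T.IsCompleteWSTS)
    (heff : T.IsInftyEffective) (s₀ : S) :
    List.TFAE [WSTS.CloverFlattable T s₀, WSTS.WeaklyCloverFlattable T s₀,
        WSTS.StronglyCloverFlattable T s₀, WSTS.CloverTerminates T s₀] ∧
      (WSTS.CloverTerminates T s₀ ↔ WSTS.CloverCanTerminate T s₀) := by
  have h12 : WSTS.CloverFlattable T s₀ → WSTS.WeaklyCloverFlattable T s₀ :=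
    WSTS.CloverFlattable.weaklyCloverFlattable
  have h24 : WSTS.WeaklyCloverFlattable T s₀ → WSTS.CloverTerminates T s₀ :=
    WSTS.WeaklyCloverFlattable.cloverTerminates hT.complete
  have h45 : WSTS.CloverTerminates T s₀ → WSTS.CloverCanTerminate T s₀ :=
    WSTS.CloverTerminates.cloverCanTerminate
  have h53 : WSTS.CloverCanTerminate T s₀ → WSTS.StronglyCloverFlattable T s₀ :=
    WSTS.CloverCanTerminate.stronglyCloverFlattable hT.complete
  have h31 : WSTS.StronglyCloverFlattable T s₀ → WSTS.CloverFlattable T s₀ :=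
    WSTS.StronglyCloverFlattable.cloverFlattable hT.complete
  refine ⟨?_, h45, fun h => h24 (h12 (h31 (h53 h)))⟩
  tfae_have 1 → 2 := h12
  tfae_have 2 → 4 := h24
  tfae_have 4 → 3 := fun h => h53 (h45 h)
  tfae_have 3 → 1 := h31
  tfae_finish
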